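/- Let $\mathbb B^3=\{x\in\mathbb R^3:|x|<1\}$ and identify $x=(x_0,x_1,x_2)\in\mathbb R^3$ with the quaternion $x_0+x_1e_1+x_2e_2$, whose conjugate is $x_0-x_1e_1-x_2e_2$. For $\mathbb R^3$-valued functions on $\mathbb B^3$ write $\langle f,g\rangle=\int_{\mathbb B^3}(f_0g_0+f_1g_1+f_2g_2)\,dV$. For $n\ge 0$ let $\mathcal H^{(n)}$ be the real vector space of polynomial maps $f=f_0+f_1e_1+f_2e_2:\mathbb B^3\to\mathbb R^3$ whose components are harmonic and homogeneous of degree $n$ (or zero), and let $\mathcal M^{(n)}$ be the space of such homogeneous polynomial maps of degree $n$ that are monogenic, i.e. $(\partial_0+e_1\partial_1+e_2\partial_2)f=0$ (quaternionic multiplication). Let $\overline{\mathcal M}^{(n)}=\{\overline f: f\in\mathcal M^{(n)}\}$. The space $\mathcal N^{(n)}$ of homogeneous contragenic polynomials of degree $n$ is the orthogonal complement of $\mathcal M^{(n)}+\overline{\mathcal M}^{(n)}$ in $\mathcal H^{(n)}$ with respect to $\langle\cdot,\cdot\rangle$. In spherical coordinates $x_0=r\cos\theta$, $x_1=r\sin\theta\cos\varphi$,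 $x_2=r\sin\theta\sin\varphi$, let $$\widehat U^n_m=r^nP_n^m(\cos\theta)\cos(m\varphi),\qquad \widehat V^n_m=r^nP_n^m(\cos\theta)\sin(m\varphi)\qquad(m\ge 0),$$ where $P_n^m(t)=(1-t^2)^{m/2}\frac{d^m}{dt^m}P_n(t)$ and $P_n$ is the Legendre polynomial of degree $n$ (so $\widehat V^n_0=0$). **Theorem.** Let $n\ge 1$ and write $d^n_m=(n-m)(n-m+1)$. The $2n-1$ functions $$Z^n_0=\widehat V^n_1e_1-\widehat U^n_1e_2,$$ $$Z^n_{m,+}=(d^n_m\widehat V^n_{m-1}+\widehat V^n_{m+1})e_1+(d^n_m\widehat U^n_{m-1}-\widehat U^n_{m+1})e_2,$$ $$Z^n_{m,-}=(d^n_m\widehat U^n_{m-1}+\widehat U^n_{m+1})e_1+(-d^n_m\widehat V^n_{m-1}+\widehat V^n_{m+1})e_2,$$ for $1\le m\le n-1$, form an orthogonal basis of $\mathcal N^{(n)}$ over $\mathbb R$. -/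

import Mathlib

open scoped Quaternion RealInnerProductSpace

noncomputable section

/-- The Euclidean space of points `x = (x₀, x₁, x₂)`, also written `x₀ + x₁ e₁ + x₂ e₂`. -/
abbrev R3 : Type := EuclideanSpace ℝ (Fin 3)

/-- The open unit ball of `R3`. -/
def unitBall : Set R3 := Metric.ball 0 1

/-! ### Solid spherical harmonics -/

/-- The Legendre polynomial `P_n` (Rodrigues formula). -/
def legendreP (n : ℕ) : Polynomial ℝ :=
  Polynomial.C (((2 : ℝ) ^ n * (n.factorial : ℝ))⁻¹) *
    (Polynomial.derivative^[n] ((Polynomial.X ^ 2 - 1) ^ n))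

/-- The associated Legendre function `P_n^m(t) = (1 - t²)^(m/2) (d/dt)^m P_n(t)`, for
`t ∈ [-1, 1]` (so without the sign `(-1)^m`). -/
def assocLegendre (n m : ℕ) (t : ℝ) : ℝ :=
  Real.sqrt (1 - t ^ 2) ^ m * (Polynomial.derivative^[m] (legendreP n)).eval t

/-- `cos θ`, where `x₀ = r cos θ`, `x₁ = r sin θ cos φ`, `x₂ = r sin θ sin φ`, `r = ‖x‖`. -/
def cosTheta (x : R3) : ℝ := x 0 / ‖x‖

/-- The angle `φ` of the spherical coordinates; on the axis `x₁ = x₂ = 0` its value is `0`. -/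
def azimuth (x : R3) : ℝ := Complex.arg ⟨x 1, x 2⟩

/-- The solid spherical harmonic `r^n P_n^m(cos θ) cos (m φ)`; for `m = 0` it is
`r^n P_n(cos θ)`. -/
def solidU (n m : ℕ) (x : R3) : ℝ :=
  ‖x‖ ^ n * (assocLegendre n m (cosTheta x) * Real.cos (m * azimuth x))

/-- The solid spherical harmonic `r^n P_n^m(cos θ) sin (m φ)`; for `m = 0` it is `0`. -/
def solidV (n m : ℕ) (x : R3) : ℝ :=
  ‖x‖ ^ n * (assocLegendre n m (cosTheta x) * Real.sin (m * azimuth x))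

/-! ### Homogeneous monogenic, ambigenic and contragenic polynomials -/

/-- The inclusion `x ↦ x₀ + x₁ e₁ + x₂ e₂` of `R3` in the quaternions. -/
def toQuaternion (v : R3) : ℍ[ℝ] := ⟨v 0, v 1, v 2, 0⟩

/-- The quaternionic conjugate `x₀ - x₁ e₁ - x₂ e₂`. -/
def conjR3 (v : R3) : R3 := !₂[v 0, -v 1, -v 2]

/-- The partial derivative `∂_j f` of a map `f : R3 → R3`. -/
def partialDeriv (j : Fin 3) (f : R3 → R3) (x : R3) : R3 :=
  fderiv ℝ f x (EuclideanSpace.single j 1)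

/-- The operator `(∂₀ + e₁ ∂₁ + e₂ ∂₂) f`, acting from the left, with values in the
quaternions. -/
def cauchyRiemannBar (f : R3 → R3) (x : R3) : ℍ[ℝ] :=
  toQuaternion (partialDeriv 0 f x)
    + ⟨0, 1, 0, 0⟩ * toQuaternion (partialDeriv 1 f x)
    + ⟨0, 0, 1, 0⟩ * toQuaternion (partialDeriv 2 f x)

/-- `u` is a real polynomial function, homogeneous of degree `n` (or zero). -/
def IsHomogeneousPoly (n : ℕ) (u : R3 → ℝ) : Prop :=
  ∃ p : MvPolynomial (Fin 3) ℝ, p.IsHomogeneous n ∧ ∀ x : R3, u x = MvPolynomial.eval (fun i => x i) p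

/-- The space `H^(n)` of `R3`-valued harmonic polynomials on the unit ball that are homogeneous of
degree `n`. -/
def homHarmonic (n : ℕ) : Set (R3 → R3) :=
  {f | ∀ i : Fin 3, IsHomogeneousPoly n (fun x => f x i) ∧
    InnerProductSpace.HarmonicOnNhd (fun x => f x i) unitBall}

/-- The space `M^(n)` of monogenic polynomials on the unit ball that are homogeneous of
degree `n`. -/
def homMonogenic (n : ℕ) : Set (R3 → R3) :=
  {f | (∀ i : Fin 3, IsHomogeneousPoly n (fun x => f x i)) ∧
    ∀ x ∈ unitBall, cauchyRiemannBar f x = 0}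

/-- The space `M^(n) + conj M^(n)` of ambigenic polynomials that are homogeneous of degree `n`. -/
def homAmbigenic (n : ℕ) : Set (R3 → R3) :=
  {f | ∃ g ∈ homMonogenic n, ∃ h ∈ homMonogenic n, f = fun x => g x + conjR3 (h x)}

/-- The inner product of `L₂(B³, R3)`: the integral of `f₀ g₀ + f₁ g₁ + f₂ g₂` over the unit
ball. -/
def ballInner (f g : R3 → R3) : ℝ := ∫ x in unitBall, ⟪f x, g x⟫

/-- The space `N^(n)` of homogeneous contragenic polynomials of degree `n`: the orthogonal
complement of `M^(n) + conj M^(n)` in `H^(n)`. -/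
def homContragenic (n : ℕ) : Set (R3 → R3) :=
  {h | h ∈ homHarmonic n ∧ ∀ f ∈ homAmbigenic n, ballInner f h = 0}

/-! ### The explicit contragenic polynomials -/

/-- `d^n_m = (n - m)(n - m + 1)`. -/
def dCoeff (n m : ℕ) : ℝ := ((n : ℝ) - m) * ((n : ℝ) - m + 1)

/-- `Z^n_0 = V^n_1 e₁ - U^n_1 e₂`. -/
def Zzero (n : ℕ) (x : R3) : R3 := !₂[0, solidV n 1 x, -solidU n 1 x]

/-- `Z^n_{m,+}`, for `m ≥ 1`. -/
def Zplus (n m : ℕ) (x : R3) : R3 :=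
  !₂[0,
    dCoeff n m * solidV n (m - 1) x + solidV n (m + 1) x,
    dCoeff n m * solidU n (m - 1) x - solidU n (m + 1) x]

/-- `Z^n_{m,-}`, for `m ≥ 1`. -/
def Zminus (n m : ℕ) (x : R3) : R3 :=
  !₂[0,
    dCoeff n m * solidU n (m - 1) x + solidU n (m + 1) x,
    -(dCoeff n m) * solidV n (m - 1) x + solidV n (m + 1) x]

/-- Index set of the family: one index for `Z^n_0`, and one each for `Z^n_{m,+}` and `Z^n_{m,-}`
with `1 ≤ m ≤ n - 1`. -/
abbrev ZIndex (n : ℕ) : Type :=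
  Unit ⊕ (Finset.Icc 1 (n - 1) ⊕ Finset.Icc 1 (n - 1))

/-- The family of all `Z^n_0`, `Z^n_{m,+}`, `Z^n_{m,-}`, `1 ≤ m ≤ n - 1`. -/
def Zfamily (n : ℕ) : ZIndex n → R3 → R3
  | Sum.inl _ => Zzero n
  | Sum.inr (Sum.inl m) => Zplus n m
  | Sum.inr (Sum.inr m) => Zminus n m

end

/-! ### Solid harmonics as coefficients of the powers of an isotropic quadratic -/

/-! The argument is a coefficient comparison in one well-chosen basis of harmonic polynomials. Write
D = ∂₁ + i∂₂ and D̄ = ∂₁ - i∂₂. The quadratic q(s) = -ζ̄ + 2x₀s + ζs² is a linear form in x whose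
coefficient vector is isotropic for every s, so the coefficients E_k (0 ≤ k ≤ 2n) of q^n are
harmonic. They span all harmonic polynomials of degree n (`harmonicSubmodule_le_span`), equal V and
U up to a factor (`solidU_add_solidV_mul_I`), and the operators ∂₀, D, D̄ merely shift k, since they
send q to 2s, -2, 2s². Conjugation sends E_k to ±E_{2n-k} (`conjPoly_solidPoly`).

Rotation invariance of the ball gives ∫ E_j E_k = 0 unless j + k = 2n. The remaining integrals D_k
(`dualPairing`) satisfy a two-term recurrence and never vanish.

Monogenic maps are exactly the conjugated gradients of harmonic polynomials of degree n + 1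
(`mem_homMonogenic_iff`). Hence a harmonic map is contragenic iff its scalar part is 0 and its
vector part, coded as H = h₁ + i h₂, satisfies ∫ (H D̄w + H̄ Dw) = 0 for all harmonic w
(`mem_homContragenic_iff`). Taking w = E_k in degree n + 1 turns this into ∫ H E_{k-2} = ∫ H̄ E_k.
For H = ∑ a_k E_k it says that a₀ = a₁ = 0 and that a_{n+1-m} is a fixed real multiple of the
conjugate of a_{n+1+m}.

So H is a sum of blocks `contraPoly n m c`, 0 ≤ m ≤ n - 1. The block m = 0 has one real parameter,
since a_{n+1} must be imaginary; every other block has one complex parameter. That gives 1 + 2(n -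
1) real dimensions, and c proportional to -i/2 (m = 0), -i and 1 (m ≥ 1) yields the three kinds of
Z. Blocks with different m are orthogonal because their indices never pair up, and within a block c
and c' give orthogonal fields when c times the conjugate of c' is imaginary. -/

/-- Complex polynomials in the coordinates `x₀, x₁, x₂`. -/
abbrev CPoly : Type := MvPolynomial (Fin 3) ℂ

/-- `ζ = x₁ + i x₂`. -/
noncomputable def zetaPoly : CPoly := .X 1 + .C Complex.I * .X 2

/-- `ζ̄ = x₁ - i x₂`. -/
noncomputable def zetaBarPoly : CPoly := .X 1 - .C Complex.I * .X 2

/-- `∂₁ + i ∂₂`. -/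
noncomputable def derivD : Derivation ℂ CPoly CPoly :=
  MvPolynomial.pderiv 1 + Complex.I • MvPolynomial.pderiv 2

/-- `∂₁ - i ∂₂`. -/
noncomputable def derivDBar : Derivation ℂ CPoly CPoly :=
  MvPolynomial.pderiv 1 - Complex.I • MvPolynomial.pderiv 2

/-- The quadratic `-ζ̄ + 2 x₀ s + ζ s²`, whose powers have harmonic coefficients. -/
noncomputable def isotropicQuadratic : Polynomial CPoly :=
  Polynomial.C (-zetaBarPoly) + Polynomial.C (2 * .X 0) * Polynomial.X
    + Polynomial.C zetaPoly * Polynomial.X ^ 2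

/-- The coefficient of `s^k` in `(-ζ̄ + 2 x₀ s + ζ s²)^n`. -/
noncomputable def solidPoly (n k : ℕ) : CPoly := (isotropicQuadratic ^ n).coeff k

/-- The Laplace operator on polynomials. -/
noncomputable def polyLaplacian {R : Type*} [CommSemiring R] (p : MvPolynomial (Fin 3) R) :
    MvPolynomial (Fin 3) R :=
  ∑ i, MvPolynomial.pderiv i (MvPolynomial.pderiv i p)

section Derivations

variable {R A : Type*} [CommRing R] [CommRing A] [Algebra R A]

theorem Derivation.coeff_mul_of_coeff (d : Derivation R A A) {G H G' H' : Polynomial A}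
    (hG : ∀ k, d (G.coeff k) = G'.coeff k) (hH : ∀ k, d (H.coeff k) = H'.coeff k) (k : ℕ) :
    d ((G * H).coeff k) = (G * H' + H * G').coeff k := by
  rw [Polynomial.coeff_add, mul_comm H G', Polynomial.coeff_mul, Polynomial.coeff_mul,
    Polynomial.coeff_mul, map_sum, ← Finset.sum_add_distrib]
  refine Finset.sum_congr rfl fun p _ => ?_
  rw [d.leibniz, hG, hH, smul_eq_mul, smul_eq_mul, mul_comm (H.coeff _)]

/-- A derivation of the coefficient ring acts coefficientwise as a derivation of the polynomial
ring, so the power rule reduces its effect on q^(n+1) to its effect on q. -/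
theorem Derivation.coeff_pow_of_coeff (d : Derivation R A A) {G G' : Polynomial A}
    (hG : ∀ k, d (G.coeff k) = G'.coeff k) (n k : ℕ) :
    d ((G ^ (n + 1)).coeff k) = (((n : Polynomial A) + 1) * G ^ n * G').coeff k := by
  induction n generalizing k with
  | zero => simp [hG]
  | succ n ih =>
    rw [pow_succ, d.coeff_mul_of_coeff ih hG]
    congr 1
    push_cast
    ring

end Derivations

theorem isotropicQuadratic_coeff (k : ℕ) :
    isotropicQuadratic.coeff k =
      if k = 0 then -zetaBarPoly else if k = 1 then 2 * .X 0 else if k = 2 then zetaPoly else 0 := by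
  unfold isotropicQuadratic
  rcases k with _ | _ | _ | k <;> simp [Polynomial.coeff_X, Polynomial.coeff_C, -map_mul, -map_neg]

theorem isotropicQuadratic_natDegree_le : isotropicQuadratic.natDegree ≤ 2 := by
  rw [Polynomial.natDegree_le_iff_coeff_eq_zero]
  intro k hk
  rw [isotropicQuadratic_coeff]
  simp [show k ≠ 0 by omega, show k ≠ 1 by omega, show k ≠ 2 by omega]

theorem solidPoly_of_lt {n k : ℕ} (h : 2 * n < k) : solidPoly n k = 0 := by
  refine Polynomial.coeff_eq_zero_of_natDegree_lt (lt_of_le_of_lt ?_ h)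
  rw [mul_comm]
  exact Polynomial.natDegree_pow_le_of_le n isotropicQuadratic_natDegree_le

theorem solidPoly_zero (n : ℕ) : solidPoly n 0 = (-zetaBarPoly) ^ n := by
  rw [solidPoly, Polynomial.coeff_zero_eq_eval_zero, Polynomial.eval_pow,
    ← Polynomial.coeff_zero_eq_eval_zero, isotropicQuadratic_coeff]
  simp

theorem solidPoly_two_mul (n : ℕ) : solidPoly n (2 * n) = zetaPoly ^ n := by
  rw [solidPoly, mul_comm, Polynomial.coeff_pow_of_natDegree_le isotropicQuadratic_natDegree_le,
    isotropicQuadratic_coeff]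
  simp

theorem zetaPoly_isHomogeneous : zetaPoly.IsHomogeneous 1 :=
  (MvPolynomial.isHomogeneous_X _ _).add ((MvPolynomial.isHomogeneous_X _ _).C_mul _)

theorem zetaBarPoly_isHomogeneous : zetaBarPoly.IsHomogeneous 1 :=
  (MvPolynomial.isHomogeneous_X _ _).sub ((MvPolynomial.isHomogeneous_X _ _).C_mul _)

theorem solidPoly_isHomogeneous (n k : ℕ) : (solidPoly n k).IsHomogeneous n := by
  induction n generalizing k with
  | zero =>
    rw [solidPoly, pow_zero, Polynomial.coeff_one]
    split_ifs
    · exact MvPolynomial.isHomogeneous_one _ _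
    · exact MvPolynomial.isHomogeneous_zero _ _ _
  | succ n ih =>
    rw [solidPoly, pow_succ, Polynomial.coeff_mul]
    refine MvPolynomial.IsHomogeneous.sum _ _ _ fun p _ => (ih _).mul ?_
    rw [isotropicQuadratic_coeff]
    split_ifs
    · exact zetaBarPoly_isHomogeneous.neg
    · rw [← map_ofNat MvPolynomial.C 2]
      exact (MvPolynomial.isHomogeneous_X _ _).C_mul _
    · exact zetaPoly_isHomogeneous
    · exact MvPolynomial.isHomogeneous_zero _ _ _

/-! ### First-order operators on the solid harmonics -/

theorem pderiv_zero_zetaPoly : MvPolynomial.pderiv 0 zetaPoly = 0 := by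
  simp [zetaPoly, MvPolynomial.pderiv_X]

theorem pderiv_zero_zetaBarPoly : MvPolynomial.pderiv 0 zetaBarPoly = 0 := by
  simp [zetaBarPoly, MvPolynomial.pderiv_X]

theorem C_I_mul_C_I : (MvPolynomial.C Complex.I * MvPolynomial.C Complex.I : CPoly) = -1 := by
  rw [← map_mul, Complex.I_mul_I, map_neg, map_one]

theorem derivD_apply (p : CPoly) : derivD p =
    MvPolynomial.pderiv 1 p + MvPolynomial.C Complex.I * MvPolynomial.pderiv 2 p := by
  simp [derivD, MvPolynomial.smul_eq_C_mul]

theorem derivDBar_apply (p : CPoly) : derivDBar p =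
    MvPolynomial.pderiv 1 p - MvPolynomial.C Complex.I * MvPolynomial.pderiv 2 p := by
  simp [derivDBar, MvPolynomial.smul_eq_C_mul]

theorem derivD_X_zero : derivD (MvPolynomial.X 0 : CPoly) = 0 := by
  simp [derivD_apply, MvPolynomial.pderiv_X]

theorem derivDBar_X_zero : derivDBar (MvPolynomial.X 0 : CPoly) = 0 := by
  simp [derivDBar_apply, MvPolynomial.pderiv_X]

theorem derivD_zetaPoly : derivD zetaPoly = 0 := by
  simp [derivD_apply, zetaPoly, MvPolynomial.pderiv_X, C_I_mul_C_I]

theorem derivD_zetaBarPoly : derivD zetaBarPoly = 2 := by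
  simp [derivD_apply, zetaBarPoly, MvPolynomial.pderiv_X, C_I_mul_C_I]
  norm_num

theorem derivDBar_zetaPoly : derivDBar zetaPoly = 2 := by
  simp [derivDBar_apply, zetaPoly, MvPolynomial.pderiv_X, C_I_mul_C_I]
  norm_num

theorem derivDBar_zetaBarPoly : derivDBar zetaBarPoly = 0 := by
  simp [derivDBar_apply, zetaBarPoly, MvPolynomial.pderiv_X, C_I_mul_C_I]

/-- The commutator of two derivations is a derivation, and this one kills every variable. -/
theorem pderiv_comm {σ R : Type*} [CommRing R] (i j : σ) (p : MvPolynomial σ R) :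
    MvPolynomial.pderiv i (MvPolynomial.pderiv j p)
      = MvPolynomial.pderiv j (MvPolynomial.pderiv i p) := by
  classical
  have h : ⁅MvPolynomial.pderiv (R := R) i, MvPolynomial.pderiv (R := R) j⁆ = 0 := by
    refine MvPolynomial.derivation_ext fun k => ?_
    rw [Derivation.commutator_apply]
    simp only [MvPolynomial.pderiv_X, Pi.single_apply, Derivation.zero_apply]
    split_ifs <;> simp
  have h2 := congrArg (fun d => d p) h
  simp only [Derivation.commutator_apply, Derivation.zero_apply] at h2
  exact sub_eq_zero.mp h2

/-- Coefficient form of ∂₀ q = 2s. Likewise, `derivD_solidPoly` is D q = -2 and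
`derivDBar_solidPoly` is D̄ q = 2s². -/
theorem pderiv_zero_solidPoly (n k : ℕ) :
    MvPolynomial.pderiv 0 (solidPoly (n + 1) (k + 1)) = 2 * ((n : CPoly) + 1) * solidPoly n k := by
  have h : ∀ k, MvPolynomial.pderiv 0 (isotropicQuadratic.coeff k)
      = (2 * Polynomial.X : Polynomial CPoly).coeff k := by
    intro k
    rw [isotropicQuadratic_coeff, show (2 : Polynomial CPoly) = Polynomial.C 2 from rfl,
      Polynomial.coeff_C_mul_X]
    have h2 : MvPolynomial.pderiv 0 (2 : CPoly) = 0 := MvPolynomial.pderiv_C (a := (2 : ℂ))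
    split_ifs <;> simp_all [pderiv_zero_zetaBarPoly, pderiv_zero_zetaPoly]
  rw [solidPoly, Derivation.coeff_pow_of_coeff _ h, solidPoly,
    show ((n : Polynomial CPoly) + 1) * isotropicQuadratic ^ n * (2 * Polynomial.X)
      = Polynomial.C (2 * ((n : CPoly) + 1)) * isotropicQuadratic ^ n * Polynomial.X by
        simp [map_ofNat Polynomial.C 2]; ring, Polynomial.coeff_mul_X, Polynomial.coeff_C_mul]

theorem pderiv_zero_solidPoly_zero (n : ℕ) : MvPolynomial.pderiv 0 (solidPoly n 0) = 0 := by
  rw [solidPoly_zero, Derivation.leibniz_pow]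
  simp [pderiv_zero_zetaBarPoly]

theorem derivD_solidPoly (n k : ℕ) :
    derivD (solidPoly (n + 1) k) = -2 * ((n : CPoly) + 1) * solidPoly n k := by
  have h : ∀ k, derivD (isotropicQuadratic.coeff k)
      = (Polynomial.C (-2) : Polynomial CPoly).coeff k := by
    intro k
    rw [isotropicQuadratic_coeff, Polynomial.coeff_C]
    have h2 : derivD (2 : CPoly) = 0 := derivD.map_natCast 2
    split_ifs <;> simp_all [derivD_zetaBarPoly, derivD_zetaPoly, derivD_X_zero]
  rw [solidPoly, Derivation.coeff_pow_of_coeff _ h, solidPoly,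
    show ((n : Polynomial CPoly) + 1) * isotropicQuadratic ^ n * Polynomial.C (-2)
      = Polynomial.C (-2 * ((n : CPoly) + 1)) * isotropicQuadratic ^ n by
        simp; ring, Polynomial.coeff_C_mul]

theorem derivDBar_coeff_isotropicQuadratic (k : ℕ) : derivDBar (isotropicQuadratic.coeff k)
      = (Polynomial.C 2 * Polynomial.X ^ 2 : Polynomial CPoly).coeff k := by
  rw [isotropicQuadratic_coeff, Polynomial.coeff_C_mul_X_pow]
  have h2 : derivDBar (2 : CPoly) = 0 := derivDBar.map_natCast 2
  split_ifs <;> simp_all [derivDBar_zetaBarPoly, derivDBar_zetaPoly, derivDBar_X_zero]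

theorem derivDBar_solidPoly (n k : ℕ) :
    derivDBar (solidPoly (n + 1) k)
      = if k < 2 then 0 else 2 * ((n : CPoly) + 1) * solidPoly n (k - 2) := by
  rw [solidPoly, Derivation.coeff_pow_of_coeff _ derivDBar_coeff_isotropicQuadratic, solidPoly,
    show ((n : Polynomial CPoly) + 1) * isotropicQuadratic ^ n
        * (Polynomial.C 2 * Polynomial.X ^ 2)
      = Polynomial.C (2 * ((n : CPoly) + 1)) * isotropicQuadratic ^ n * Polynomial.X ^ 2 by
        simp [map_ofNat Polynomial.C 2]; ring, Polynomial.coeff_mul_X_pow']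
  split_ifs with h1 h2 h2
  · omega
  · rw [Polynomial.coeff_C_mul]
  · rfl
  · omega

theorem polyLaplacian_eq (p : CPoly) : polyLaplacian p =
    MvPolynomial.pderiv 0 (MvPolynomial.pderiv 0 p) + derivD (derivDBar p) := by
  simp only [polyLaplacian, Fin.sum_univ_three, derivD_apply, derivDBar_apply, map_sub,
    MvPolynomial.pderiv_C_mul]
  linear_combination (MvPolynomial.pderiv 2 (MvPolynomial.pderiv 2 p)) * C_I_mul_C_I
    - MvPolynomial.C Complex.I * pderiv_comm 2 1 p

theorem derivD_derivDBar (p : CPoly) : derivD (derivDBar p) = derivDBar (derivD p) := by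
  simp only [derivD_apply, derivDBar_apply, map_sub, map_add,
    MvPolynomial.pderiv_C_mul]
  linear_combination (2 * MvPolynomial.C Complex.I) * pderiv_comm 2 1 p

theorem pderiv_zero_derivD (p : CPoly) :
    MvPolynomial.pderiv 0 (derivD p) = derivD (MvPolynomial.pderiv 0 p) := by
  simp only [derivD_apply, map_add, MvPolynomial.pderiv_C_mul]
  rw [pderiv_comm 0 1, pderiv_comm 0 2]

theorem pderiv_zero_derivDBar (p : CPoly) :
    MvPolynomial.pderiv 0 (derivDBar p) = derivDBar (MvPolynomial.pderiv 0 p) := by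
  simp only [derivDBar_apply, map_sub, MvPolynomial.pderiv_C_mul]
  rw [pderiv_comm 0 1, pderiv_comm 0 2]

/-- Harmonic polynomials that are homogeneous of degree `n`. -/
noncomputable def harmonicSubmodule (n : ℕ) : Submodule ℂ CPoly where
  carrier := {p | p.IsHomogeneous n ∧ polyLaplacian p = 0}
  add_mem' := by
    rintro p q ⟨hp, hp'⟩ ⟨hq, hq'⟩
    refine ⟨hp.add hq, ?_⟩
    have h : polyLaplacian (p + q) = polyLaplacian p + polyLaplacian q := by
      simp [polyLaplacian, Finset.sum_add_distrib]
    rw [h, hp', hq', add_zero]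
  zero_mem' := ⟨MvPolynomial.isHomogeneous_zero _ _ _, by simp [polyLaplacian]⟩
  smul_mem' := by
    rintro c p ⟨hp, hp'⟩
    refine ⟨?_, ?_⟩
    · rw [MvPolynomial.smul_eq_C_mul]
      exact hp.C_mul c
    · have h : polyLaplacian (c • p) = c • polyLaplacian p := by
        simp [polyLaplacian, Finset.smul_sum]
      rw [h, hp', smul_zero]

/-- The Laplacian is ∂₀² + D D̄, and on powers of q its symbol is (2s)² + (-2)(2s²) = 0. The cases
of small n and k are those where a shifted index or exponent would be negative. -/
theorem solidPoly_mem_harmonicSubmodule (n k : ℕ) : solidPoly n k ∈ harmonicSubmodule n := by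
  refine ⟨solidPoly_isHomogeneous n k, ?_⟩
  have hnat : ∀ (d : Derivation ℂ CPoly CPoly) (m : ℕ) (p : CPoly),
      d (2 * ((m : CPoly) + 1) * p) = 2 * ((m : CPoly) + 1) * d p := by
    intro d m p
    have := d.map_natCast (2 * (m + 1))
    push_cast at this
    rw [d.leibniz, this]
    simp
  have h0 : ∀ (i : Fin 3) (j : ℕ), MvPolynomial.pderiv i (solidPoly 0 j) = 0 := by
    intro i j
    rw [solidPoly, pow_zero, Polynomial.coeff_one]
    split_ifs
    · exact MvPolynomial.pderiv_one
    · exact map_zero _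
  rw [polyLaplacian_eq, derivD_derivDBar]
  rcases n with _ | _ | n
  · simp only [derivD_apply, h0, map_zero, mul_zero, add_zero]
  · rw [derivD_solidPoly, show (-2 * (((0 : ℕ) : CPoly) + 1) * solidPoly 0 k)
      = 2 * (((0 : ℕ) : CPoly) + 1) * (-solidPoly 0 k) by ring, hnat]
    rcases k with _ | k
    · rw [pderiv_zero_solidPoly_zero, map_neg]
      simp [derivDBar_apply, h0]
    · rw [pderiv_zero_solidPoly, hnat, map_neg]
      simp [derivDBar_apply, h0]
  · rw [derivD_solidPoly, show (-2 * (((n + 1 : ℕ) : CPoly) + 1) * solidPoly (n + 1) k)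
      = 2 * (((n + 1 : ℕ) : CPoly) + 1) * (-solidPoly (n + 1) k) by ring, hnat, map_neg,
      derivDBar_solidPoly]
    rcases k with _ | _ | k
    · rw [pderiv_zero_solidPoly_zero]
      simp
    · rw [pderiv_zero_solidPoly, hnat, pderiv_zero_solidPoly_zero]
      simp
    · rw [pderiv_zero_solidPoly, hnat, pderiv_zero_solidPoly]
      simp

/-! ### The solid harmonics span the harmonic polynomials -/

/-- Twice Euler's identity, with 2(x₁∂₁ + x₂∂₂) rewritten as ζ D̄ + ζ̄ D. -/
theorem euler_identity {n : ℕ} {p : CPoly} (h : p.IsHomogeneous n) :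
    (2 * n : CPoly) * p = 2 * .X 0 * MvPolynomial.pderiv 0 p + zetaPoly * derivDBar p
      + zetaBarPoly * derivD p := by
  have := h.sum_X_mul_pderiv
  rw [Fin.sum_univ_three, nsmul_eq_mul] at this
  rw [derivD_apply, derivDBar_apply, zetaPoly, zetaBarPoly]
  linear_combination (-2 : CPoly) * this
    + (2 * .X 2 * MvPolynomial.pderiv 2 p) * C_I_mul_C_I

theorem derivD_isHomogeneous {n : ℕ} {p : CPoly} (h : p.IsHomogeneous n) :
    (derivD p).IsHomogeneous (n - 1) := by
  rw [derivD_apply]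
  exact h.pderiv.add (h.pderiv.C_mul _)

theorem derivDBar_isHomogeneous {n : ℕ} {p : CPoly} (h : p.IsHomogeneous n) :
    (derivDBar p).IsHomogeneous (n - 1) := by
  rw [derivDBar_apply]
  exact h.pderiv.sub (h.pderiv.C_mul _)

theorem eq_C_mul_of_two_mul_eq {n : ℕ} {p q : CPoly} (h : (2 * ((n : CPoly) + 1)) * p = q) :
    p = MvPolynomial.C (2 * ((n : ℂ) + 1))⁻¹ * q := by
  have hn : (2 * ((n : ℂ) + 1)) ≠ 0 := mul_ne_zero two_ne_zero (Nat.cast_add_one_ne_zero n)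
  have hC : (MvPolynomial.C (2 * ((n : ℂ) + 1)) : CPoly) = 2 * ((n : CPoly) + 1) := by
    simp [map_ofNat MvPolynomial.C 2]
  rw [← h, ← hC, ← mul_assoc, ← map_mul, inv_mul_cancel₀ hn, map_one, one_mul]

/-- When ∂₀p = Dp = 0, Euler's identity recovers p from D̄p alone, and D̄p satisfies the same
hypotheses in one degree less. -/
theorem exists_eq_zetaPoly_pow (n : ℕ) (p : CPoly) (h : p.IsHomogeneous n)
    (h0 : MvPolynomial.pderiv 0 p = 0) (hD : derivD p = 0) :
    ∃ c : ℂ, p = MvPolynomial.C c * zetaPoly ^ n := by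
  induction n generalizing p with
  | zero =>
    rw [← MvPolynomial.totalDegree_zero_iff_isHomogeneous,
      MvPolynomial.totalDegree_eq_zero_iff_eq_C] at h
    exact ⟨_, by rw [pow_zero, mul_one]; exact h⟩
  | succ n ih =>
    obtain ⟨c, hc⟩ := ih (derivDBar p) (derivDBar_isHomogeneous h)
      (by rw [pderiv_zero_derivDBar, h0, map_zero]) (by rw [derivD_derivDBar, hD, map_zero])
    have he := euler_identity h
    rw [h0, hD, hc] at he
    push_cast at he
    refine ⟨(2 * ((n : ℂ) + 1))⁻¹ * c, ?_⟩
    rw [eq_C_mul_of_two_mul_eq he, map_mul]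
    ring

theorem exists_eq_zetaBarPoly_pow (n : ℕ) (p : CPoly) (h : p.IsHomogeneous n)
    (h0 : MvPolynomial.pderiv 0 p = 0) (hD : derivDBar p = 0) :
    ∃ c : ℂ, p = MvPolynomial.C c * zetaBarPoly ^ n := by
  induction n generalizing p with
  | zero =>
    rw [← MvPolynomial.totalDegree_zero_iff_isHomogeneous,
      MvPolynomial.totalDegree_eq_zero_iff_eq_C] at h
    exact ⟨_, by rw [pow_zero, mul_one]; exact h⟩
  | succ n ih =>
    obtain ⟨c, hc⟩ := ih (derivD p) (derivD_isHomogeneous h)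
      (by rw [pderiv_zero_derivD, h0, map_zero]) (by rw [← derivD_derivDBar, hD, map_zero])
    have he := euler_identity h
    rw [h0, hD, hc] at he
    push_cast at he
    refine ⟨(2 * ((n : ℂ) + 1))⁻¹ * c, ?_⟩
    rw [eq_C_mul_of_two_mul_eq he, map_mul]
    ring

theorem span_le_harmonicSubmodule (n : ℕ) :
    Submodule.span ℂ (Set.range (solidPoly n)) ≤ harmonicSubmodule n := by
  rw [Submodule.span_le]
  rintro _ ⟨k, rfl⟩
  exact solidPoly_mem_harmonicSubmodule _ _

theorem exists_pderiv_zero_eq_of_mem_span {n : ℕ} {q : CPoly}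
    (hq : q ∈ Submodule.span ℂ (Set.range (solidPoly n))) :
    ∃ r ∈ Submodule.span ℂ (Set.range (solidPoly (n + 1))), MvPolynomial.pderiv 0 r = q := by
  induction hq using Submodule.span_induction with
  | mem q hq =>
    obtain ⟨k, rfl⟩ := hq
    refine ⟨(2 * ((n : ℂ) + 1))⁻¹ • solidPoly (n + 1) (k + 1),
      Submodule.smul_mem _ _ (Submodule.subset_span ⟨_, rfl⟩), ?_⟩
    rw [Derivation.map_smul, MvPolynomial.smul_eq_C_mul]
    exact (eq_C_mul_of_two_mul_eq (pderiv_zero_solidPoly n k).symm).symm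
  | zero => exact ⟨0, zero_mem _, map_zero _⟩
  | add q q' _ _ h h' =>
    obtain ⟨r, hr, rfl⟩ := h
    obtain ⟨r', hr', rfl⟩ := h'
    exact ⟨r + r', add_mem hr hr', map_add _ _ _⟩
  | smul c q _ h =>
    obtain ⟨r, hr, rfl⟩ := h
    exact ⟨c • r, Submodule.smul_mem _ _ hr, Derivation.map_smul _ _ _⟩

/-- By induction ∂₀p lies in the span in degree n, where ∂₀ has a right inverse because it shifts k.
Subtracting a preimage leaves a harmonic polynomial independent of x₀, and such a polynomial is a
combination of ζ^(n+1) and ζ̄^(n+1), the two extreme coefficients of q^(n+1). -/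
theorem harmonicSubmodule_le_span (n : ℕ) :
    harmonicSubmodule n ≤ Submodule.span ℂ (Set.range (solidPoly n)) := by
  induction n with
  | zero =>
    rintro p ⟨h, -⟩
    rw [← MvPolynomial.totalDegree_zero_iff_isHomogeneous,
      MvPolynomial.totalDegree_eq_zero_iff_eq_C] at h
    rw [h, ← mul_one (MvPolynomial.C _), ← pow_zero (-zetaBarPoly), ← solidPoly_zero,
      ← MvPolynomial.smul_eq_C_mul]
    exact Submodule.smul_mem _ _ (Submodule.subset_span ⟨0, rfl⟩)
  | succ n ih =>
    -- With ∂₀p = 0, harmonicity reads D D̄p = 0, so D̄p and Dp are multiples of ζ^n and ζ̄^n;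
    -- Euler's identity then rebuilds p.
    have hflat : ∀ p ∈ harmonicSubmodule (n + 1), MvPolynomial.pderiv 0 p = 0 →
        p ∈ Submodule.span ℂ (Set.range (solidPoly (n + 1))) := by
      rintro p ⟨h, hL⟩ h0
      rw [polyLaplacian_eq, h0, map_zero, zero_add] at hL
      obtain ⟨a, ha⟩ := exists_eq_zetaPoly_pow n (derivDBar p) (derivDBar_isHomogeneous h)
        (by rw [pderiv_zero_derivDBar, h0, map_zero]) hL
      obtain ⟨b, hb⟩ := exists_eq_zetaBarPoly_pow n (derivD p) (derivD_isHomogeneous h)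
        (by rw [pderiv_zero_derivD, h0, map_zero]) (by rw [← derivD_derivDBar, hL])
      have he := euler_identity h
      rw [h0, ha, hb] at he
      push_cast at he
      have hs : p = ((2 * ((n : ℂ) + 1))⁻¹ * a) • solidPoly (n + 1) (2 * (n + 1))
          + ((2 * ((n : ℂ) + 1))⁻¹ * b * (-1) ^ (n + 1)) • solidPoly (n + 1) 0 := by
        rw [eq_C_mul_of_two_mul_eq he, solidPoly_two_mul, solidPoly_zero,
          MvPolynomial.smul_eq_C_mul, MvPolynomial.smul_eq_C_mul, neg_pow zetaBarPoly]
        simp only [map_mul, map_pow, map_neg, map_one]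
        have hsq : ((-1) ^ (n + 1) * (-1) ^ (n + 1) : CPoly) = 1 := by
          rw [← mul_pow]
          simp
        linear_combination (-MvPolynomial.C (2 * ((n : ℂ) + 1))⁻¹ * MvPolynomial.C b
          * zetaBarPoly ^ (n + 1)) * hsq
      rw [hs]
      exact add_mem (Submodule.smul_mem _ _ (Submodule.subset_span ⟨_, rfl⟩))
        (Submodule.smul_mem _ _ (Submodule.subset_span ⟨_, rfl⟩))
    rintro p hp
    have h0 : MvPolynomial.pderiv 0 p ∈ harmonicSubmodule n := by
      refine ⟨hp.1.pderiv, ?_⟩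
      have h2 := congrArg (MvPolynomial.pderiv 0) hp.2
      rw [polyLaplacian_eq, map_add, pderiv_zero_derivD, pderiv_zero_derivDBar, map_zero] at h2
      rw [polyLaplacian_eq, h2]
    obtain ⟨r, hr, hrp⟩ := exists_pderiv_zero_eq_of_mem_span (ih h0)
    have := hflat (p - r) (sub_mem hp (span_le_harmonicSubmodule _ hr)) (by rw [map_sub, hrp, sub_self])
    simpa using add_mem this hr

theorem exists_pderiv_zero_eq {n : ℕ} {q : CPoly} (hq : q ∈ harmonicSubmodule n) :
    ∃ r ∈ harmonicSubmodule (n + 1), MvPolynomial.pderiv 0 r = q := by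
  obtain ⟨r, hr, h⟩ := exists_pderiv_zero_eq_of_mem_span (harmonicSubmodule_le_span n hq)
  exact ⟨r, span_le_harmonicSubmodule _ hr, h⟩

/-! ### Conjugation and rotations -/

/-- Conjugation of the coefficients. -/
noncomputable def conjPoly : CPoly →+* CPoly := MvPolynomial.map (starRingEnd ℂ)

theorem conjPoly_C (c : ℂ) :
    conjPoly (MvPolynomial.C c) = MvPolynomial.C (starRingEnd ℂ c) := by
  simp [conjPoly]

theorem conjPoly_X (i : Fin 3) : conjPoly (MvPolynomial.X i) = MvPolynomial.X i := by
  simp [conjPoly]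

theorem conjPoly_zetaPoly : conjPoly zetaPoly = zetaBarPoly := by
  rw [zetaPoly, map_add, map_mul, conjPoly_C, conjPoly_X, conjPoly_X, Complex.conj_I, map_neg,
    zetaBarPoly]
  ring

theorem conjPoly_conjPoly (p : CPoly) : conjPoly (conjPoly p) = p := by
  simp [conjPoly, MvPolynomial.map_map, MvPolynomial.map_id]

theorem conjPoly_zetaBarPoly : conjPoly zetaBarPoly = zetaPoly := by
  rw [← conjPoly_zetaPoly, conjPoly_conjPoly]

/-- Conjugating the coefficients of q gives -s² q(-1/s), so that of q^n is (-1)^n s^(2n) q(-1/s)^n.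
Reversal of coefficients replaces the Laurent expression. -/
theorem conjPoly_solidPoly {n k : ℕ} (hk : k ≤ 2 * n) :
    conjPoly (solidPoly n k) = (-1) ^ (n + k) * solidPoly n (2 * n - k) := by
  have hdeg : ∀ m, (isotropicQuadratic ^ m).natDegree ≤ m * 2 := fun m =>
    Polynomial.natDegree_pow_le_of_le m isotropicQuadratic_natDegree_le
  have hrefl : ∀ m, Polynomial.reflect (m * 2) (isotropicQuadratic ^ m)
      = Polynomial.reflect 2 isotropicQuadratic ^ m := by
    intro m
    induction m with
    | zero => simp
    | succ m ih =>
      rw [pow_succ, add_one_mul, Polynomial.reflect_mul _ _ (hdeg m)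
        isotropicQuadratic_natDegree_le, ih, pow_succ]
  have hmap : isotropicQuadratic.map conjPoly
      = -(Polynomial.reflect 2 isotropicQuadratic).comp (Polynomial.C (-1) * Polynomial.X) := by
    ext1 k
    rw [Polynomial.coeff_map, Polynomial.coeff_neg, Polynomial.comp_C_mul_X_coeff,
      Polynomial.coeff_reflect]
    rcases k with _ | _ | _ | k
    · simp [isotropicQuadratic_coeff, conjPoly_zetaBarPoly]
    · simp [isotropicQuadratic_coeff, conjPoly_X, Polynomial.revAt_le, map_ofNat]
    · simp [isotropicQuadratic_coeff, conjPoly_zetaPoly]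
    · rw [Polynomial.revAt_eq_self_of_lt (by omega)]
      simp [isotropicQuadratic_coeff]
  rw [solidPoly, ← Polynomial.coeff_map, Polynomial.map_pow, hmap,
    neg_pow ((Polynomial.reflect 2 isotropicQuadratic).comp _), ← Polynomial.pow_comp,
    ← hrefl, show ((-1 : Polynomial CPoly) ^ n) = Polynomial.C ((-1) ^ n) by simp,
    Polynomial.coeff_C_mul, Polynomial.comp_C_mul_X_coeff, Polynomial.coeff_reflect,
    Polynomial.revAt_le (by omega), solidPoly, pow_add, mul_comm n 2]
  ring

/-- The infinitesimal rotation `x_i ∂_j - x_j ∂_i`. -/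
noncomputable def rotationDeriv (i j : Fin 3) : Derivation ℂ CPoly CPoly :=
  (MvPolynomial.X i : CPoly) • MvPolynomial.pderiv j
    - (MvPolynomial.X j : CPoly) • MvPolynomial.pderiv i

theorem rotationDeriv_apply (i j : Fin 3) (p : CPoly) : rotationDeriv i j p =
    .X i * MvPolynomial.pderiv j p - .X j * MvPolynomial.pderiv i p := by
  simp [rotationDeriv]

/-- The raising operator `ζ ∂₀ - x₀ (∂₁ + i ∂₂)`. -/
noncomputable def raisingDeriv : Derivation ℂ CPoly CPoly :=
  rotationDeriv 1 0 + Complex.I • rotationDeriv 2 0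

theorem raisingDeriv_apply (p : CPoly) :
    raisingDeriv p = zetaPoly * MvPolynomial.pderiv 0 p - .X 0 * derivD p := by
  simp only [raisingDeriv, Derivation.add_apply, Derivation.smul_apply, rotationDeriv_apply,
    MvPolynomial.smul_eq_C_mul, derivD_apply, zetaPoly]
  ring

/-- The raising operator acts on q, hence on its powers, as d/ds. -/
theorem raisingDeriv_solidPoly (n k : ℕ) :
    raisingDeriv (solidPoly n k) = ((k : CPoly) + 1) * solidPoly n (k + 1) := by
  rcases n with _ | n
  · have h : ∀ j, (1 : Polynomial CPoly).coeff j = MvPolynomial.C (if j = 0 then 1 else 0) := by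
      intro j
      rw [Polynomial.coeff_one]
      split_ifs <;> simp
    simp only [solidPoly, pow_zero]
    rw [h, h, raisingDeriv_apply, derivD_apply, MvPolynomial.pderiv_C, MvPolynomial.pderiv_C,
      MvPolynomial.pderiv_C]
    simp
  have h : ∀ k, raisingDeriv (isotropicQuadratic.coeff k)
      = (Polynomial.derivative isotropicQuadratic).coeff k := by
    intro k
    have h2 : raisingDeriv (2 : CPoly) = 0 := raisingDeriv.map_natCast 2
    have hz : raisingDeriv (MvPolynomial.X 0) = zetaPoly := by
      simp [raisingDeriv_apply, derivD_X_zero]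
    have hb : raisingDeriv zetaBarPoly = -2 * .X 0 := by
      simp [raisingDeriv_apply, derivD_zetaBarPoly, pderiv_zero_zetaBarPoly, mul_comm]
    have hzeta : raisingDeriv zetaPoly = 0 := by
      simp [raisingDeriv_apply, derivD_zetaPoly, pderiv_zero_zetaPoly]
    rw [Polynomial.coeff_derivative, isotropicQuadratic_coeff, isotropicQuadratic_coeff]
    rcases k with _ | _ | _ | k
    · simp [hb]
    · simp [h2, hz]
      ring
    · simp [hzeta]
    · simp
  rw [solidPoly, Derivation.coeff_pow_of_coeff _ h, solidPoly, mul_comm ((k : CPoly) + 1),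
    ← Polynomial.coeff_derivative, Polynomial.derivative_pow]
  simp

/-- The rotation about the x₀-axis sends q to i(s q' - q), hence q^n to i(s d/ds - n) q^n: the
weight of E_k is k - n. -/
theorem rotationDeriv_solidPoly (n k : ℕ) : rotationDeriv 1 2 (solidPoly n k)
    = MvPolynomial.C Complex.I * ((k : CPoly) - (n : CPoly)) * solidPoly n k := by
  rcases n with _ | n
  · have h : ∀ j, (1 : Polynomial CPoly).coeff j = MvPolynomial.C (if j = 0 then 1 else 0) := by
      intro j
      rw [Polynomial.coeff_one]
      split_ifs <;> simp
    simp only [solidPoly, pow_zero]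
    rw [rotationDeriv_apply, h, MvPolynomial.pderiv_C, MvPolynomial.pderiv_C]
    split_ifs with hk <;> simp [hk]
  have h : ∀ k, rotationDeriv 1 2 (isotropicQuadratic.coeff k)
      = (Polynomial.C (MvPolynomial.C Complex.I) * (Polynomial.derivative isotropicQuadratic
        * Polynomial.X - isotropicQuadratic)).coeff k := by
    intro k
    have h2 : rotationDeriv 1 2 (2 : CPoly) = 0 := (rotationDeriv 1 2).map_natCast 2
    have hz : rotationDeriv 1 2 (MvPolynomial.X 0) = 0 := by
      simp [rotationDeriv_apply, MvPolynomial.pderiv_X]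
    have hb : rotationDeriv 1 2 zetaBarPoly = -(MvPolynomial.C Complex.I * zetaBarPoly) := by
      simp [rotationDeriv_apply, zetaBarPoly, MvPolynomial.pderiv_X]
      linear_combination (-MvPolynomial.X 2 : CPoly) * C_I_mul_C_I
    have hzeta : rotationDeriv 1 2 zetaPoly = MvPolynomial.C Complex.I * zetaPoly := by
      simp [rotationDeriv_apply, zetaPoly, MvPolynomial.pderiv_X]
      linear_combination (-MvPolynomial.X 2 : CPoly) * C_I_mul_C_I
    rw [Polynomial.coeff_C_mul, Polynomial.coeff_sub]
    rcases k with _ | k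
    · rw [Polynomial.coeff_mul_X_zero]
      simp [isotropicQuadratic_coeff, hb]
    rw [Polynomial.coeff_mul_X, Polynomial.coeff_derivative, isotropicQuadratic_coeff]
    rcases k with _ | _ | k
    · simp [h2, hz]
    · simp [hzeta]
      ring
    · simp
  rw [solidPoly, Derivation.coeff_pow_of_coeff _ h,
    show ((n : Polynomial CPoly) + 1) * isotropicQuadratic ^ n
        * (Polynomial.C (MvPolynomial.C Complex.I) * (Polynomial.derivative isotropicQuadratic
          * Polynomial.X - isotropicQuadratic))
      = Polynomial.C (MvPolynomial.C Complex.I)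
          * (Polynomial.derivative (isotropicQuadratic ^ (n + 1)) * Polynomial.X
            - Polynomial.C ((n : CPoly) + 1) * isotropicQuadratic ^ (n + 1)) by
      rw [Polynomial.derivative_pow]; simp; ring,
    Polynomial.coeff_C_mul, Polynomial.coeff_sub, Polynomial.coeff_C_mul]
  rcases k with _ | k
  · rw [Polynomial.coeff_mul_X_zero]
    push_cast
    ring
  · rw [Polynomial.coeff_mul_X, Polynomial.coeff_derivative]
    push_cast
    ring

/-! ### Calculus of polynomial functions -/

section PolynomialFunctions

variable {A : Type*} [NormedCommRing A] [NormedAlgebra ℝ A]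

/-- The value of a polynomial with coefficients in a real algebra at a point of `R3`. -/
noncomputable def evalAt (x : R3) : MvPolynomial (Fin 3) A →+* A :=
  MvPolynomial.eval fun i => algebraMap ℝ A (x i)

theorem hasFDerivAt_evalAt (p : MvPolynomial (Fin 3) A) (x : R3) :
    HasFDerivAt (fun y => evalAt y p)
      (∑ j, (EuclideanSpace.proj j : R3 →L[ℝ] ℝ).smulRight (evalAt x (MvPolynomial.pderiv j p)))
      x := by
  induction p using MvPolynomial.induction_on with
  | C a => simpa [evalAt] using hasFDerivAt_const a x
  | add p q hp hq =>
    simp only [map_add]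
    refine (hp.add hq).congr_fderiv ?_
    rw [← Finset.sum_add_distrib]
    refine Finset.sum_congr rfl fun j _ => ?_
    ext v
    simp
  | mul_X p i hp =>
    have hX : HasFDerivAt (fun y : R3 => algebraMap ℝ A (y i))
        ((EuclideanSpace.proj i : R3 →L[ℝ] ℝ).smulRight (1 : A)) x := by
      have := ((EuclideanSpace.proj i : R3 →L[ℝ] ℝ).smulRight (1 : A)).hasFDerivAt (x := x)
      refine this.congr_of_eventuallyEq (Filter.Eventually.of_forall fun y => ?_)
      simp [Algebra.algebraMap_eq_smul_one]
    have he : (fun y => evalAt y (p * MvPolynomial.X i))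
        = fun y => evalAt y p * algebraMap ℝ A (y i) := by
      funext y
      simp [evalAt]
    rw [he]
    refine (hp.mul hX).congr_fderiv ?_
    ext v
    simp only [Derivation.leibniz, MvPolynomial.pderiv_X, smul_eq_mul, map_add, map_mul]
    simp [Fin.sum_univ_three, evalAt, Algebra.smul_def, Pi.single_apply, apply_ite]
    fin_cases i <;> simp <;> ring

theorem contDiff_evalAt {n : WithTop ℕ∞} (p : MvPolynomial (Fin 3) A) :
    ContDiff ℝ n fun y => evalAt y p := by
  induction p using MvPolynomial.induction_on with
  | C a => simpa [evalAt] using contDiff_const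
  | add p q hp hq => simpa only [map_add] using hp.add hq
  | mul_X p i hp =>
    have hX : ContDiff ℝ n fun y : R3 => algebraMap ℝ A (y i) :=
      (algebraMapCLM ℝ A).contDiff.comp (EuclideanSpace.proj i : R3 →L[ℝ] ℝ).contDiff
    simpa [evalAt] using hp.mul hX

theorem continuous_evalAt (p : MvPolynomial (Fin 3) A) : Continuous fun y => evalAt y p :=
  continuous_iff_continuousAt.2 fun x => (hasFDerivAt_evalAt p x).continuousAt

theorem fderiv_evalAt (p : MvPolynomial (Fin 3) A) (x : R3) (j : Fin 3) :
    fderiv ℝ (fun y => evalAt y p) x (EuclideanSpace.single j 1)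
      = evalAt x (MvPolynomial.pderiv j p) := by
  rw [(hasFDerivAt_evalAt p x).fderiv]
  simp

end PolynomialFunctions

/-! ### Integration over the unit ball -/

/-- Extension of scalars of real polynomials. -/
noncomputable def complexify : MvPolynomial (Fin 3) ℝ →+* CPoly := MvPolynomial.map Complex.ofRealHom

theorem evalAt_complexify (x : R3) (p : MvPolynomial (Fin 3) ℝ) :
    evalAt x (complexify p) = ((evalAt x p : ℝ) : ℂ) := by
  induction p using MvPolynomial.induction_on with
  | C a => simp [complexify, evalAt]
  | add p q hp hq => simp only [map_add, hp, hq, Complex.ofReal_add]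
  | mul_X p i hp => simp only [map_mul, hp, Complex.ofReal_mul]; simp [evalAt, complexify]

theorem evalAt_C (x : R3) (c : ℂ) : evalAt x (MvPolynomial.C c : CPoly) = c := by
  simp [evalAt]

theorem evalAt_conjPoly (x : R3) (p : CPoly) :
    evalAt x (conjPoly p) = starRingEnd ℂ (evalAt x p) := by
  induction p using MvPolynomial.induction_on with
  | C a => rw [conjPoly_C, evalAt_C, evalAt_C]
  | add p q hp hq => simp only [map_add, hp, hq]
  | mul_X p i hp => simp only [map_mul, hp, conjPoly_X]; simp [evalAt]

theorem evalAt_integrable {A : Type*} [NormedCommRing A] [NormedAlgebra ℝ A]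
    (p : MvPolynomial (Fin 3) A) :
    MeasureTheory.IntegrableOn (fun x => evalAt x p) unitBall :=
  ((continuous_evalAt p).continuousOn.integrableOn_compact
    (isCompact_closedBall (0 : R3) 1)).mono_set Metric.ball_subset_closedBall

theorem isOpen_unitBall : IsOpen unitBall := Metric.isOpen_ball

theorem measurableSet_unitBall : MeasurableSet unitBall := isOpen_unitBall.measurableSet

/-- Integration of polynomials over the unit ball. -/
noncomputable def ballIntegral : CPoly →ₗ[ℂ] ℂ where
  toFun p := ∫ x in unitBall, evalAt x p
  map_add' p q := by
    simp only [map_add]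
    exact MeasureTheory.integral_add (evalAt_integrable p) (evalAt_integrable q)
  map_smul' c p := by
    simp only [MvPolynomial.smul_eq_C_mul, map_mul, evalAt_C, RingHom.id_apply, smul_eq_mul]
    exact MeasureTheory.integral_const_mul c _

theorem ballIntegral_C_mul (c : ℂ) (p : CPoly) :
    ballIntegral (MvPolynomial.C c * p) = c * ballIntegral p := by
  rw [← MvPolynomial.smul_eq_C_mul, map_smul, smul_eq_mul]

theorem mem_unitBall_of_abs_lt {x : R3} (h : ∀ i, |x i| < 1 / 2) : x ∈ unitBall := by
  rw [unitBall, mem_ball_zero_iff, EuclideanSpace.norm_eq, Real.sqrt_lt' one_pos,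
    Fin.sum_univ_three]
  have hsq : ∀ i, ‖x i‖ ^ 2 < (1 / 2) ^ 2 := fun i => by
    rw [Real.norm_eq_abs]
    exact pow_lt_pow_left₀ (h i) (abs_nonneg _) two_ne_zero
  have h0 := hsq 0
  have h1 := hsq 1
  have h2 := hsq 2
  linarith

/-- The ball contains a product of infinite real intervals, on which a polynomial is determined by
its values. -/
theorem eq_zero_of_evalAt_eq_zero {p : CPoly} (h : ∀ x ∈ unitBall, evalAt x p = 0) : p = 0 := by
  refine MvPolynomial.funext_set (fun _ => Complex.ofReal '' Set.Ioo (-(1 / 2)) (1 / 2))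
    (fun _ => (Set.Ioo_infinite (by norm_num)).image Complex.ofReal_injective.injOn) ?_
  intro y hy
  choose x hx hxy using fun i => hy i (Set.mem_univ i)
  have := h (WithLp.toLp 2 x) (mem_unitBall_of_abs_lt fun i => abs_lt.2 (hx i))
  rw [map_zero, ← this, evalAt]
  congr 2
  funext i
  exact (hxy i).symm

/-- The integral is that of |p|², so continuity forces p to vanish on the ball. This positivity is
the source of every nonvanishing statement below. -/
theorem eq_zero_of_ballIntegral_mul_conjPoly {p : CPoly}
    (h : ballIntegral (p * conjPoly p) = 0) : p = 0 := by
  refine eq_zero_of_evalAt_eq_zero fun x hx => ?_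
  have he : ∀ x, evalAt x (p * conjPoly p) = ((‖evalAt x p‖ ^ 2 : ℝ) : ℂ) := fun x => by
    rw [map_mul, evalAt_conjPoly, Complex.mul_conj, Complex.normSq_eq_norm_sq]
  have hc : Continuous fun x : R3 => ‖evalAt x p‖ ^ 2 := (continuous_evalAt p).norm.pow 2
  have hi : ∫ x in unitBall, ‖evalAt x p‖ ^ 2 = 0 := by
    have h2 : ballIntegral (p * conjPoly p) = ∫ x in unitBall, evalAt x (p * conjPoly p) := rfl
    simp only [h2, he] at h
    have h3 := h.symm.trans integral_complex_ofReal
    exact_mod_cast h3.symm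
  have hint : MeasureTheory.IntegrableOn (fun x : R3 => ‖evalAt x p‖ ^ 2) unitBall :=
    (hc.continuousOn.integrableOn_compact
      (isCompact_closedBall (0 : R3) 1)).mono_set Metric.ball_subset_closedBall
  rw [MeasureTheory.integral_eq_zero_iff_of_nonneg (fun x => by positivity) hint] at hi
  have := MeasureTheory.Measure.eqOn_open_of_ae_eq (U := unitBall) hi isOpen_unitBall
    hc.continuousOn continuousOn_const hx
  simpa using this

/-! ### Rotation invariance of the integral -/

/-- The rotation by the angle `α` in the plane of the coordinates `i`, `j`. -/
noncomputable def planeRotation (i j : Fin 3) (α : ℝ) (x : R3) : R3 :=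
  WithLp.toLp 2 fun k => if k = i then Real.cos α * x i - Real.sin α * x j
    else if k = j then Real.sin α * x i + Real.cos α * x j else x k

theorem norm_planeRotation {i j : Fin 3} (hij : i ≠ j) (α : ℝ) (x : R3) :
    ‖planeRotation i j α x‖ = ‖x‖ := by
  rw [EuclideanSpace.norm_eq, EuclideanSpace.norm_eq]
  congr 1
  simp only [planeRotation, Fin.sum_univ_three, Real.norm_eq_abs, sq_abs]
  have h := Real.sin_sq_add_cos_sq α
  fin_cases i <;> fin_cases j <;> simp at hij ⊢
  · linear_combination (x 0 ^ 2 + x 1 ^ 2) * h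
  · linear_combination (x 0 ^ 2 + x 2 ^ 2) * h
  · linear_combination (x 1 ^ 2 + x 0 ^ 2) * h
  · linear_combination (x 1 ^ 2 + x 2 ^ 2) * h
  · linear_combination (x 2 ^ 2 + x 0 ^ 2) * h
  · linear_combination (x 2 ^ 2 + x 1 ^ 2) * h

/-- `planeRotation` as a linear isometry. -/
noncomputable def planeRotationIsometry {i j : Fin 3} (hij : i ≠ j) (α : ℝ) : R3 →ₗᵢ[ℝ] R3 where
  toFun := planeRotation i j α
  map_add' x y := by
    ext k
    simp only [planeRotation, PiLp.add_apply]
    split_ifs <;> ring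
  map_smul' c x := by
    ext k
    simp only [planeRotation, PiLp.smul_apply, smul_eq_mul, RingHom.id_apply]
    split_ifs <;> ring
  norm_map' := norm_planeRotation hij α

theorem setIntegral_unitBall_planeRotation {i j : Fin 3} (hij : i ≠ j) (α : ℝ) (f : R3 → ℂ) :
    ∫ x in unitBall, f (planeRotation i j α x) = ∫ x in unitBall, f x := by
  let e : R3 ≃ₗᵢ[ℝ] R3 := (planeRotationIsometry hij α).toLinearIsometryEquiv rfl
  have he : ∀ x, e x = planeRotation i j α x := fun x => rfl
  have := e.measurePreserving.setIntegral_preimage_emb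
    e.toHomeomorph.measurableEmbedding f unitBall
  rw [unitBall, e.preimage_ball, map_zero] at this
  simpa only [he, unitBall] using this

theorem hasDerivAt_planeRotation {i j : Fin 3} (hij : i ≠ j) (α : ℝ) (x : R3) :
    HasDerivAt (fun α => planeRotation i j α x)
      (EuclideanSpace.single j (planeRotation i j α x i)
        - EuclideanSpace.single i (planeRotation i j α x j)) α := by
  suffices h : ∀ k, HasDerivAt (fun α => planeRotation i j α x k)
      ((EuclideanSpace.single j (planeRotation i j α x i)
        - EuclideanSpace.single i (planeRotation i j α x j) : R3) k) α from
    (PiLp.continuousLinearEquiv 2 ℝ fun _ : Fin 3 => ℝ).symm.hasFDerivAt.comp_hasDerivAt α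
      (hasDerivAt_pi.2 h)
  intro k
  have hs := Real.hasDerivAt_sin α
  have hc := Real.hasDerivAt_cos α
  by_cases hi : k = i
  · subst hi
    simp only [planeRotation, PiLp.sub_apply, PiLp.single_apply, if_true, hij, hij.symm,
      if_false]
    exact ((hc.mul_const _).sub (hs.mul_const _)).congr_deriv (by ring)
  by_cases hj : k = j
  · subst hj
    simp only [planeRotation, PiLp.sub_apply, PiLp.single_apply, if_true, hi,
      if_false]
    exact ((hs.mul_const _).add (hc.mul_const _)).congr_deriv (by ring)
  · simp only [planeRotation, PiLp.sub_apply, PiLp.single_apply, hi, hj, if_false]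
    simpa using hasDerivAt_const α (x k)

theorem hasDerivAt_evalAt_planeRotation {i j : Fin 3} (hij : i ≠ j) (p : CPoly) (α : ℝ) (x : R3) :
    HasDerivAt (fun α => evalAt (planeRotation i j α x) p)
      (evalAt (planeRotation i j α x) (rotationDeriv i j p)) α := by
  refine ((hasFDerivAt_evalAt p _).comp_hasDerivAt α
    (hasDerivAt_planeRotation hij α x)).congr_deriv ?_
  generalize planeRotation i j α x = y
  rw [rotationDeriv_apply]
  have hX : ∀ k, evalAt y (.X k : CPoly) = y k := fun k => by simp [evalAt]
  have hs : ∀ (k : Fin 3) (c : ℝ), (∑ l, (EuclideanSpace.proj l : R3 →L[ℝ] ℝ).smulRight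
      (evalAt y (MvPolynomial.pderiv l p))) (EuclideanSpace.single k c)
        = c * evalAt y (MvPolynomial.pderiv k p) := fun k c => by simp
  simp only [map_sub, map_mul, hX, hs]

/-- The integral of p over the rotated ball does not depend on the angle; its derivative at angle 0
is the left-hand side. -/
theorem ballIntegral_rotationDeriv {i j : Fin 3} (hij : i ≠ j) (p : CPoly) :
    ballIntegral (rotationDeriv i j p) = 0 := by
  -- A bound on the closed ball dominates the derivative for all angles at once, since rotations
  -- preserve the norm.
  obtain ⟨M, hM⟩ := (isCompact_closedBall (0 : R3) 1).exists_bound_of_continuousOn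
    (continuous_evalAt (rotationDeriv i j p)).continuousOn
  have hcont : ∀ (q : CPoly) (α : ℝ), Continuous fun x => evalAt (planeRotation i j α x) q :=
    fun q α => (continuous_evalAt q).comp (planeRotationIsometry hij α).continuous
  have hint : ∀ (q : CPoly) (α : ℝ), MeasureTheory.IntegrableOn
      (fun x => evalAt (planeRotation i j α x) q) unitBall := fun q α =>
    ((hcont q α).continuousOn.integrableOn_compact
      (isCompact_closedBall (0 : R3) 1)).mono_set Metric.ball_subset_closedBall
  have hder := (hasDerivAt_integral_of_dominated_loc_of_deriv_le
    (μ := MeasureTheory.volume.restrict unitBall) (bound := fun _ => M) (x₀ := (0 : ℝ))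
    (F := fun α x => evalAt (planeRotation i j α x) p)
    (F' := fun α x => evalAt (planeRotation i j α x) (rotationDeriv i j p)) Filter.univ_mem
    (Filter.Eventually.of_forall fun α => (hcont p α).aestronglyMeasurable)
    (hint p 0) (hcont _ 0).aestronglyMeasurable
    ((MeasureTheory.ae_restrict_iff' measurableSet_unitBall).2
      (Filter.Eventually.of_forall fun x hx α _ => hM _ ?_))
    ((continuousOn_const.integrableOn_compact
      (isCompact_closedBall (0 : R3) 1)).mono_set Metric.ball_subset_closedBall)
    (Filter.Eventually.of_forall fun x α _ =>
      hasDerivAt_evalAt_planeRotation hij p α x)).2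
  · simp only [setIntegral_unitBall_planeRotation hij _ (fun x => evalAt x p),
      setIntegral_unitBall_planeRotation hij _ (fun x => evalAt x (rotationDeriv i j p))] at hder
    exact hder.unique (hasDerivAt_const _ _)
  · rw [mem_closedBall_zero_iff, norm_planeRotation hij]
    exact (mem_ball_zero_iff.1 hx).le

theorem ballIntegral_raisingDeriv (p : CPoly) : ballIntegral (raisingDeriv p) = 0 := by
  rw [raisingDeriv, Derivation.add_apply, Derivation.smul_apply, map_add, map_smul,
    ballIntegral_rotationDeriv (by decide), ballIntegral_rotationDeriv (by decide), smul_zero,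
    add_zero]

/-! ### Orthogonality relations of the solid harmonics -/

/-- The product is an eigenvector of the rotation about the x₀-axis with eigenvalue i(j + k - 2n),
and the integral of its image vanishes. -/
theorem ballIntegral_solidPoly_mul_of_ne {n j k : ℕ} (h : j + k ≠ 2 * n) :
    ballIntegral (solidPoly n j * solidPoly n k) = 0 := by
  have hr := ballIntegral_rotationDeriv (i := 1) (j := 2) (by decide)
    (solidPoly n j * solidPoly n k)
  have he : rotationDeriv 1 2 (solidPoly n j * solidPoly n k)
      = MvPolynomial.C (Complex.I * ((j : ℂ) + k - 2 * n)) * (solidPoly n j * solidPoly n k) := by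
    rw [Derivation.leibniz, rotationDeriv_solidPoly, rotationDeriv_solidPoly]
    simp [map_ofNat MvPolynomial.C 2]
    ring
  rw [he, ballIntegral_C_mul] at hr
  refine (mul_eq_zero.1 hr).resolve_left (mul_ne_zero Complex.I_ne_zero ?_)
  rw [sub_ne_zero]
  exact_mod_cast h

/-- The integral of the product of two dual solid harmonics. -/
noncomputable def dualPairing (n k : ℕ) : ℂ :=
  ballIntegral (solidPoly n k * solidPoly n (2 * n - k))

theorem ballIntegral_solidPoly_mul {n j k : ℕ} (h : j + k = 2 * n) :
    ballIntegral (solidPoly n j * solidPoly n k) = dualPairing n j := by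
  rw [dualPairing, ← h, Nat.add_sub_cancel_left]

/-- Integrate the raising operator applied to E_k E_{2n-k-1}; the Leibniz rule produces exactly the
two neighbouring pairings. -/
theorem dualPairing_succ {n k : ℕ} (hk : k < 2 * n) :
    ((k : ℂ) + 1) * dualPairing n (k + 1) = -(2 * (n : ℂ) - k) * dualPairing n k := by
  have hr := ballIntegral_raisingDeriv (solidPoly n k * solidPoly n (2 * n - (k + 1)))
  rw [Derivation.leibniz, raisingDeriv_solidPoly, raisingDeriv_solidPoly, smul_eq_mul, smul_eq_mul,
    show 2 * n - (k + 1) + 1 = 2 * n - k by omega] at hr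
  have he : solidPoly n k * ((((2 * n - (k + 1) : ℕ) : CPoly) + 1) * solidPoly n (2 * n - k))
      + solidPoly n (2 * n - (k + 1)) * (((k : CPoly) + 1) * solidPoly n (k + 1))
      = MvPolynomial.C (2 * (n : ℂ) - k) * (solidPoly n k * solidPoly n (2 * n - k))
        + MvPolynomial.C ((k : ℂ) + 1)
          * (solidPoly n (k + 1) * solidPoly n (2 * n - (k + 1))) := by
    rw [Nat.cast_sub (by omega)]
    simp [map_ofNat MvPolynomial.C 2]
    ring
  rw [he, map_add, ballIntegral_C_mul, ballIntegral_C_mul] at hr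
  rw [dualPairing, dualPairing]
  linear_combination hr

/-- For k = 0 the pairing is ±∫ |E₀|², because E_{2n} is ± the conjugate of E₀; the recurrence has
nonzero factors for k < 2n. -/
theorem dualPairing_ne_zero {n k : ℕ} (hk : k ≤ 2 * n) : dualPairing n k ≠ 0 := by
  induction k with
  | zero =>
    intro h0
    have hs : conjPoly (solidPoly n 0) = (-1) ^ n * solidPoly n (2 * n) := by
      simpa using conjPoly_solidPoly (n := n) (k := 0) (by omega)
    have hz : solidPoly n 0 = 0 := by
      refine eq_zero_of_ballIntegral_mul_conjPoly ?_
      rw [hs, show solidPoly n 0 * ((-1) ^ n * solidPoly n (2 * n))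
        = MvPolynomial.C ((-1) ^ n) * (solidPoly n 0 * solidPoly n (2 * n - 0)) by simp; ring,
        ballIntegral_C_mul]
      exact mul_eq_zero_of_right _ h0
    rw [solidPoly_zero] at hz
    have hzb := neg_eq_zero.1 ((pow_eq_zero_iff (n := n) ?_).1 hz)
    · have h2 := derivD_zetaBarPoly
      rw [hzb, map_zero] at h2
      exact two_ne_zero h2.symm
    · rintro rfl
      simp at hz
  | succ k ih =>
    intro h
    have hr := dualPairing_succ (n := n) (k := k) (by omega)
    rw [h, mul_zero] at hr
    refine mul_ne_zero (neg_ne_zero.2 ?_) (ih (by omega)) hr.symm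
    rw [sub_ne_zero]
    norm_cast
    omega

theorem dualPairing_add_two {n k : ℕ} (hk : k + 2 ≤ 2 * n) :
    ((k : ℂ) + 1) * ((k : ℂ) + 2) * dualPairing n (k + 2)
      = (2 * (n : ℂ) - k) * (2 * (n : ℂ) - k - 1) * dualPairing n k := by
  have h1 := dualPairing_succ (n := n) (k := k) (by omega)
  have h2 := dualPairing_succ (n := n) (k := k + 1) (by omega)
  push_cast at h2
  rw [show k + 1 + 1 = k + 2 from rfl] at h2
  linear_combination ((k : ℂ) + 1) * h2 - (2 * (n : ℂ) - k - 1) * h1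

/-! ### Comparison with the associated Legendre functions -/

/-- Expand (a + (b + cs)s)^n, with j counting the factors a. The monomial s^(n-j) comes for free, so
(b + cs)^(n-j) must supply s^(m+j). -/
theorem coeff_quadratic_pow {R : Type*} [CommRing R] (a b c : R) (n m : ℕ) :
    ((Polynomial.C a + Polynomial.C b * Polynomial.X
      + Polynomial.C c * Polynomial.X ^ 2) ^ n).coeff (n + m)
      = ∑ j ∈ Finset.range (n + 1), (n.choose j * (n - j).choose (m + j) : ℕ)
        * (a ^ j * b ^ (n - j - (m + j)) * c ^ (m + j)) := by
  have hlin : ∀ N k, ((Polynomial.C b + Polynomial.C c * Polynomial.X) ^ N).coeff k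
      = b ^ (N - k) * N.choose k * c ^ k := by
    intro N k
    have : Polynomial.C b + Polynomial.C c * Polynomial.X
        = (Polynomial.X + Polynomial.C b).comp (Polynomial.C c * Polynomial.X) := by
      simp [add_comm]
    rw [this, ← Polynomial.pow_comp, Polynomial.comp_C_mul_X_coeff,
      Polynomial.coeff_X_add_C_pow]
  rw [show Polynomial.C a + Polynomial.C b * Polynomial.X + Polynomial.C c * Polynomial.X ^ 2
    = Polynomial.C a + (Polynomial.C b + Polynomial.C c * Polynomial.X) * Polynomial.X by ring,
    add_pow, Polynomial.finsetSum_coeff]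
  refine Finset.sum_congr rfl fun j hj => ?_
  have hjn : j ≤ n := Nat.lt_succ_iff.1 (Finset.mem_range.1 hj)
  rw [mul_pow, ← map_pow, show Polynomial.C (a ^ j)
      * ((Polynomial.C b + Polynomial.C c * Polynomial.X) ^ (n - j) * Polynomial.X ^ (n - j))
      * (n.choose j : Polynomial R)
    = Polynomial.C (a ^ j * n.choose j)
      * (Polynomial.C b + Polynomial.C c * Polynomial.X) ^ (n - j) * Polynomial.X ^ (n - j) by
    simp; ring, show n + m = m + j + (n - j) by omega, Polynomial.coeff_mul_X_pow,
    Polynomial.coeff_C_mul, hlin]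
  push_cast
  ring

/-- By Rodrigues this is a Taylor coefficient at t of (X² - 1)^n. The shift turns X² - 1 into (t² -
1) + 2tX + X², the same kind of trinomial as q. -/
theorem eval_iterate_derivative_legendreP (n m : ℕ) (t : ℝ) :
    (Polynomial.derivative^[m] (legendreP n)).eval t
      = ((2 : ℝ) ^ n * n.factorial)⁻¹ * ((n + m).factorial
        * ∑ j ∈ Finset.range (n + 1), (n.choose j * (n - j).choose (m + j) : ℕ)
          * ((t ^ 2 - 1) ^ j * (2 * t) ^ (n - j - (m + j)))) := by
  have htaylor : Polynomial.taylor t ((Polynomial.X ^ 2 - 1 : Polynomial ℝ) ^ n)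
      = (Polynomial.C (t ^ 2 - 1) + Polynomial.C (2 * t) * Polynomial.X
        + Polynomial.C 1 * Polynomial.X ^ 2) ^ n := by
    simp only [Polynomial.taylor_apply, Polynomial.pow_comp, Polynomial.sub_comp,
      Polynomial.X_comp, Polynomial.one_comp, map_sub, map_pow, map_mul, map_one]
    congr 1
    rw [map_ofNat Polynomial.C 2]
    ring
  rw [legendreP, Polynomial.iterate_derivative_C_mul, Polynomial.eval_C_mul,
    ← Function.iterate_add_apply, add_comm m n, ← Polynomial.factorial_smul_hasseDeriv]
  rw [LinearMap.smul_apply, Polynomial.eval_smul, nsmul_eq_mul, ← Polynomial.taylor_coeff, htaylor, coeff_quadratic_pow]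
  simp

theorem evalAt_solidPoly (x : R3) (n m : ℕ) : evalAt x (solidPoly n (n + m))
    = ∑ j ∈ Finset.range (n + 1), (n.choose j * (n - j).choose (m + j) : ℕ)
      * ((-evalAt x zetaBarPoly) ^ j * (2 * (x 0 : ℂ)) ^ (n - j - (m + j))
        * evalAt x zetaPoly ^ (m + j)) := by
  rw [solidPoly, isotropicQuadratic, coeff_quadratic_pow, map_sum]
  refine Finset.sum_congr rfl fun j _ => ?_
  simp only [map_mul, map_pow, map_neg, map_natCast, map_ofNat]
  simp [evalAt]

/-- The factor `(n + m)! / (2^n n!)`. -/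
noncomputable def rodriguesFactor (n m : ℕ) : ℝ :=
  ((2 : ℝ) ^ n * n.factorial)⁻¹ * (n + m).factorial

theorem norm_sq_R3 (x : R3) : ‖x‖ ^ 2 = x 0 ^ 2 + x 1 ^ 2 + x 2 ^ 2 := by
  rw [EuclideanSpace.norm_sq_eq, Fin.sum_univ_three]
  simp

theorem evalAt_zetaPoly (x : R3) : evalAt x zetaPoly = ⟨x 1, x 2⟩ := by
  rw [Complex.mk_eq_add_mul_I]
  simp [evalAt, zetaPoly, mul_comm]

theorem evalAt_zetaBarPoly (x : R3) : evalAt x zetaBarPoly = starRingEnd ℂ (evalAt x zetaPoly) := by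
  rw [← evalAt_conjPoly, conjPoly_zetaPoly]

theorem zeta_polar {x : R3} (hx : x ≠ 0) :
    (‖x‖ : ℂ) * ((Real.sqrt (1 - cosTheta x ^ 2) : ℝ) : ℂ) * Complex.exp (azimuth x * Complex.I)
      = evalAt x zetaPoly := by
  have hr : 0 < ‖x‖ := norm_pos_iff.2 hx
  have hn : ‖(⟨x 1, x 2⟩ : ℂ)‖ = ‖x‖ * Real.sqrt (1 - cosTheta x ^ 2) := by
    rw [← Real.sqrt_sq hr.le, ← Real.sqrt_mul (sq_nonneg _), Complex.norm_def]
    congr 1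
    rw [cosTheta, Complex.normSq_mk, div_pow, mul_sub,
      mul_div_cancel₀ _ (pow_ne_zero 2 hr.ne'), norm_sq_R3]
    ring
  rw [evalAt_zetaPoly, azimuth]
  conv_rhs => rw [← Complex.norm_mul_exp_arg_mul_I (⟨x 1, x 2⟩ : ℂ), hn]
  push_cast
  rfl

/-- Both sides are trinomial expansions with the same binomial coefficients. Off the origin the
terms match through ζ = r sin θ e^(iφ), x₀ = r cos θ and ζζ̄ = r²(1 - cos² θ). -/
theorem solidU_add_solidV_mul_I {n : ℕ} (hn : 1 ≤ n) (m : ℕ) (x : R3) :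
    (solidU n m x : ℂ) + solidV n m x * Complex.I
      = rodriguesFactor n m * evalAt x (solidPoly n (n + m)) := by
  by_cases hx : x = 0
  · subst hx
    have h0 : evalAt (0 : R3) (solidPoly n (n + m)) = 0 := by
      have h : evalAt (0 : R3) (solidPoly n (n + m))
          = MvPolynomial.constantCoeff (solidPoly n (n + m)) := by
        simp [evalAt]
      rw [h, MvPolynomial.constantCoeff_eq]
      exact (solidPoly_isHomogeneous n (n + m)).coeff_eq_zero (by simp; omega)
    rw [h0]
    simp [solidU, solidV, show n ≠ 0 by omega]
  have hr : (‖x‖ : ℂ) ≠ 0 := by exact_mod_cast norm_ne_zero_iff.2 hx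
  have hexp : (solidU n m x : ℂ) + solidV n m x * Complex.I
      = ‖x‖ ^ n * ((Real.sqrt (1 - cosTheta x ^ 2) : ℝ) : ℂ) ^ m
        * Complex.exp (azimuth x * Complex.I) ^ m
        * ((Polynomial.derivative^[m] (legendreP n)).eval (cosTheta x) : ℝ) := by
    rw [← Complex.exp_nat_mul, show (m : ℂ) * (azimuth x * Complex.I)
      = ((m * azimuth x : ℝ) : ℂ) * Complex.I by push_cast; ring, Complex.exp_mul_I, solidU, solidV,
      assocLegendre]
    push_cast
    ring
  rw [hexp, eval_iterate_derivative_legendreP, evalAt_solidPoly, rodriguesFactor]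
  push_cast
  simp only [Finset.mul_sum]
  refine Finset.sum_congr rfl fun j _ => ?_
  -- Here the binomial coefficient vanishes; otherwise the truncated exponent is a true difference.
  by_cases hc : n - j < m + j
  · rw [Nat.choose_eq_zero_of_lt hc]
    simp
  obtain ⟨k, hk⟩ : ∃ k, n = m + 2 * j + k := ⟨n - (m + 2 * j), by omega⟩
  have hz : (‖x‖ : ℂ) * cosTheta x = x 0 := by
    rw [cosTheta]
    push_cast
    field_simp
  have hzz : (‖x‖ : ℂ) ^ 2 * (cosTheta x ^ 2 - 1)
      = -(evalAt x zetaBarPoly * evalAt x zetaPoly) := by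
    rw [mul_sub, ← mul_pow, hz, mul_one, evalAt_zetaBarPoly, ← Complex.normSq_eq_conj_mul_self,
      evalAt_zetaPoly, Complex.normSq_mk, ← Complex.ofReal_pow ‖x‖, norm_sq_R3]
    push_cast
    ring
  rw [show n - j - (m + j) = k by omega]
  have hpow : (‖x‖ : ℂ) ^ n = ‖x‖ ^ m * (‖x‖ ^ 2) ^ j * ‖x‖ ^ k := by
    rw [hk]
    ring
  have key : (‖x‖ : ℂ) ^ n * ((Real.sqrt (1 - cosTheta x ^ 2) : ℝ) : ℂ) ^ m
        * Complex.exp (azimuth x * Complex.I) ^ m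
        * (((cosTheta x : ℂ) ^ 2 - 1) ^ j * (2 * (cosTheta x : ℂ)) ^ k)
      = (-evalAt x zetaBarPoly) ^ j * (2 * (x 0 : ℂ)) ^ k * evalAt x zetaPoly ^ (m + j) := by
    rw [hpow, show (‖x‖ : ℂ) ^ m * (‖x‖ ^ 2) ^ j * ‖x‖ ^ k
        * ((Real.sqrt (1 - cosTheta x ^ 2) : ℝ) : ℂ) ^ m
        * Complex.exp (azimuth x * Complex.I) ^ m
        * (((cosTheta x : ℂ) ^ 2 - 1) ^ j * (2 * (cosTheta x : ℂ)) ^ k)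
      = ((‖x‖ : ℂ) * ((Real.sqrt (1 - cosTheta x ^ 2) : ℝ) : ℂ)
          * Complex.exp (azimuth x * Complex.I)) ^ m
        * ((‖x‖ : ℂ) ^ 2 * ((cosTheta x : ℂ) ^ 2 - 1)) ^ j
        * (2 * ((‖x‖ : ℂ) * cosTheta x)) ^ k by simp only [mul_pow]; ring,
      zeta_polar hx, hzz, hz, neg_pow, neg_pow (evalAt x zetaBarPoly), mul_pow, pow_add]
    ring
  rw [← key]
  ring

/-! ### Real and complex harmonic polynomials -/

theorem complexify_coeff (p : MvPolynomial (Fin 3) ℝ) (d : Fin 3 →₀ ℕ) :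
    (complexify p).coeff d = ((p.coeff d : ℝ) : ℂ) := by
  rw [complexify, MvPolynomial.coeff_map]
  rfl

theorem pderiv_complexify (i : Fin 3) (p : MvPolynomial (Fin 3) ℝ) :
    MvPolynomial.pderiv i (complexify p) = complexify (MvPolynomial.pderiv i p) :=
  MvPolynomial.pderiv_map

theorem polyLaplacian_complexify (p : MvPolynomial (Fin 3) ℝ) :
    polyLaplacian (complexify p) = complexify (polyLaplacian p) := by
  simp only [polyLaplacian, pderiv_complexify, map_sum]

theorem conjPoly_complexify (p : MvPolynomial (Fin 3) ℝ) :
    conjPoly (complexify p) = complexify p := by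
  rw [conjPoly, complexify, MvPolynomial.map_map]
  exact congrArg (fun f => MvPolynomial.map f p) (RingHom.ext fun r => Complex.conj_ofReal r)

theorem complexify_injective : Function.Injective complexify :=
  MvPolynomial.map_injective _ Complex.ofReal_injective

theorem complexify_mem_harmonicSubmodule {n : ℕ} {p : MvPolynomial (Fin 3) ℝ}
    (h : p.IsHomogeneous n) (hL : polyLaplacian p = 0) : complexify p ∈ harmonicSubmodule n :=
  ⟨h.map _, by rw [polyLaplacian_complexify, hL, map_zero]⟩

theorem complexify_add_I_mul_eq_zero {a b : MvPolynomial (Fin 3) ℝ}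
    (h : complexify a + MvPolynomial.C Complex.I * complexify b = 0) : a = 0 ∧ b = 0 := by
  have hd : ∀ d, ((a.coeff d : ℝ) : ℂ) + Complex.I * ((b.coeff d : ℝ) : ℂ) = 0 := fun d => by
    rw [← complexify_coeff, ← complexify_coeff, ← MvPolynomial.coeff_C_mul,
      ← MvPolynomial.coeff_add, h, MvPolynomial.coeff_zero]
  constructor <;> ext d
  · simpa using congrArg Complex.re (hd d)
  · simpa using congrArg Complex.im (hd d)

theorem exists_complexify_add_I_mul (q : CPoly) : ∃ a b : MvPolynomial (Fin 3) ℝ,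
    q = complexify a + MvPolynomial.C Complex.I * complexify b := by
  induction q using MvPolynomial.induction_on with
  | C c =>
    refine ⟨MvPolynomial.C c.re, MvPolynomial.C c.im, ?_⟩
    simp only [complexify, MvPolynomial.map_C, Complex.ofRealHom_eq_coe]
    rw [← map_mul, ← map_add, mul_comm, Complex.re_add_im]
  | add p q hp hq =>
    obtain ⟨a, b, rfl⟩ := hp
    obtain ⟨a', b', rfl⟩ := hq
    exact ⟨a + a', b + b', by simp only [map_add]; ring⟩
  | mul_X p i hp =>
    obtain ⟨a, b, rfl⟩ := hp
    refine ⟨a * .X i, b * .X i, ?_⟩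
    have : complexify (.X i) = .X i := by simp [complexify]
    simp only [map_mul, this]
    ring

theorem exists_real_harmonic_of_mem_harmonicSubmodule {n : ℕ} {q : CPoly}
    (hq : q ∈ harmonicSubmodule n) : ∃ a b : MvPolynomial (Fin 3) ℝ,
      (a.IsHomogeneous n ∧ polyLaplacian a = 0) ∧ (b.IsHomogeneous n ∧ polyLaplacian b = 0) ∧
      q = complexify a + MvPolynomial.C Complex.I * complexify b := by
  obtain ⟨a, b, rfl⟩ := exists_complexify_add_I_mul q
  obtain ⟨hh, hL⟩ := hq
  have hcoeff : ∀ d, (complexify a + MvPolynomial.C Complex.I * complexify b).coeff d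
      = ((a.coeff d : ℝ) : ℂ) + Complex.I * ((b.coeff d : ℝ) : ℂ) := fun d => by
    rw [MvPolynomial.coeff_add, MvPolynomial.coeff_C_mul, complexify_coeff, complexify_coeff]
  have hlap : polyLaplacian (complexify a + MvPolynomial.C Complex.I * complexify b)
      = complexify (polyLaplacian a) + MvPolynomial.C Complex.I * complexify (polyLaplacian b) := by
    rw [← polyLaplacian_complexify, ← polyLaplacian_complexify]
    simp only [polyLaplacian, map_add, MvPolynomial.pderiv_C_mul, Finset.sum_add_distrib,
      Finset.mul_sum]
  obtain ⟨ha, hb⟩ := complexify_add_I_mul_eq_zero (hlap.symm.trans hL)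
  refine ⟨a, b, ⟨fun d hd => hh ?_, ha⟩, ⟨fun d hd => hh ?_, hb⟩, rfl⟩
  · rw [hcoeff]
    intro h0
    exact hd (by simpa using congrArg Complex.re h0)
  · rw [hcoeff]
    intro h0
    exact hd (by simpa using congrArg Complex.im h0)

theorem laplacian_evalAt (p : MvPolynomial (Fin 3) ℝ) (x : R3) :
    Laplacian.laplacian (fun y : R3 => evalAt y p) x = evalAt x (polyLaplacian p) := by
  have hder : ∀ j y, fderiv ℝ (fun y : R3 => evalAt y p) y (EuclideanSpace.single j 1)
      = evalAt y (MvPolynomial.pderiv j p) := fun j y => fderiv_evalAt p y j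
  have hd : DifferentiableAt ℝ (fderiv ℝ fun y : R3 => evalAt y p) x :=
    ((contDiff_evalAt (n := 2) p).fderiv_right (m := 1) (by norm_num)).differentiable
      (by norm_num) x
  rw [InnerProductSpace.laplacian_eq_iteratedFDeriv_orthonormalBasis _
    (EuclideanSpace.basisFun (Fin 3) ℝ), polyLaplacian, map_sum]
  refine Finset.sum_congr rfl fun j _ => ?_
  rw [iteratedFDeriv_two_apply]
  simp only [Matrix.cons_val_zero, Matrix.cons_val_one, EuclideanSpace.basisFun_apply]
  have h2 := (hd.hasFDerivAt.clm_apply (hasFDerivAt_const (EuclideanSpace.single j 1) x)).fderiv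
  have h3 := congrArg (fun L => L (EuclideanSpace.single j 1)) h2
  simp only [hder, fderiv_evalAt] at h3
  rw [h3]
  simp

theorem polynomial_eq_zero_of_evalAt_eq_zero {p : MvPolynomial (Fin 3) ℝ}
    (h : ∀ x ∈ unitBall, evalAt x p = 0) : p = 0 := by
  apply complexify_injective
  rw [map_zero]
  refine eq_zero_of_evalAt_eq_zero fun x hx => ?_
  rw [evalAt_complexify, h x hx, Complex.ofReal_zero]

theorem harmonicOnNhd_evalAt_iff (p : MvPolynomial (Fin 3) ℝ) :
    InnerProductSpace.HarmonicOnNhd (fun x : R3 => evalAt x p) unitBall ↔ polyLaplacian p = 0 := by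
  constructor
  · intro h
    refine polynomial_eq_zero_of_evalAt_eq_zero fun x hx => ?_
    rw [← laplacian_evalAt]
    exact (h x hx).2.self_of_nhds
  · intro h x _
    refine ⟨(contDiff_evalAt p).contDiffAt, Filter.Eventually.of_forall fun y => ?_⟩
    rw [laplacian_evalAt, h, map_zero]
    rfl

/-- The map with given polynomial components. -/
noncomputable def polyMap (p : Fin 3 → MvPolynomial (Fin 3) ℝ) (x : R3) : R3 :=
  WithLp.toLp 2 fun i => evalAt x (p i)

theorem mem_homHarmonic_iff {n : ℕ} {f : R3 → R3} : f ∈ homHarmonic n ↔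
    ∃ p : Fin 3 → MvPolynomial (Fin 3) ℝ,
      (∀ i, (p i).IsHomogeneous n ∧ polyLaplacian (p i) = 0) ∧ f = polyMap p := by
  constructor
  · intro h
    choose p hp using fun i => (h i).1
    refine ⟨p, fun i => ⟨(hp i).1, ?_⟩, ?_⟩
    · rw [← harmonicOnNhd_evalAt_iff]
      have := (h i).2
      rwa [show (fun x => f x i) = fun x => evalAt x (p i) from funext (hp i).2] at this
    · funext x
      ext i
      exact (hp i).2 x
  · rintro ⟨p, hp, rfl⟩ i
    exact ⟨⟨p i, (hp i).1, fun x => rfl⟩, (harmonicOnNhd_evalAt_iff (p i)).2 (hp i).2⟩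

theorem partialDeriv_polyMap (p : Fin 3 → MvPolynomial (Fin 3) ℝ) (j : Fin 3) (x : R3) :
    partialDeriv j (polyMap p) x = polyMap (fun i => MvPolynomial.pderiv j (p i)) x := by
  have h : HasFDerivAt (polyMap p) _ x :=
    (PiLp.continuousLinearEquiv 2 ℝ fun _ : Fin 3 => ℝ).symm.hasFDerivAt.comp x
      (hasFDerivAt_pi.2 fun i => hasFDerivAt_evalAt (p i) x)
  rw [partialDeriv, h.fderiv]
  ext i
  simp [polyMap]

/-- The map `(∂₀ u, -∂₁ u, -∂₂ u)`. -/
noncomputable def conjGradient (u : MvPolynomial (Fin 3) ℝ) : R3 → R3 :=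
  polyMap ![MvPolynomial.pderiv 0 u, -MvPolynomial.pderiv 1 u, -MvPolynomial.pderiv 2 u]

theorem cauchyRiemannBar_polyMap (p : Fin 3 → MvPolynomial (Fin 3) ℝ) (x : R3) :
    cauchyRiemannBar (polyMap p) x =
      ⟨evalAt x (.pderiv 0 (p 0) - .pderiv 1 (p 1) - .pderiv 2 (p 2)),
       evalAt x (.pderiv 0 (p 1) + .pderiv 1 (p 0)),
       evalAt x (.pderiv 0 (p 2) + .pderiv 2 (p 0)),
       evalAt x (.pderiv 1 (p 2) - .pderiv 2 (p 1))⟩ := by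
  rw [cauchyRiemannBar, partialDeriv_polyMap, partialDeriv_polyMap, partialDeriv_polyMap]
  apply Quaternion.ext
  · refine ((Quaternion.re_add _ _).trans (congrArg₂ (· + ·) ((Quaternion.re_add _ _).trans
      (congrArg₂ (· + ·) rfl (Quaternion.re_mul _ _))) (Quaternion.re_mul _ _))).trans ?_
    simp [toQuaternion, polyMap]
    ring
  · refine ((Quaternion.imI_add _ _).trans (congrArg₂ (· + ·) ((Quaternion.imI_add _ _).trans
      (congrArg₂ (· + ·) rfl (Quaternion.imI_mul _ _))) (Quaternion.imI_mul _ _))).trans ?_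
    simp [toQuaternion, polyMap]
  · refine ((Quaternion.imJ_add _ _).trans (congrArg₂ (· + ·) ((Quaternion.imJ_add _ _).trans
      (congrArg₂ (· + ·) rfl (Quaternion.imJ_mul _ _))) (Quaternion.imJ_mul _ _))).trans ?_
    simp [toQuaternion, polyMap]
  · refine ((Quaternion.imK_add _ _).trans (congrArg₂ (· + ·) ((Quaternion.imK_add _ _).trans
      (congrArg₂ (· + ·) rfl (Quaternion.imK_mul _ _))) (Quaternion.imK_mul _ _))).trans ?_
    simp [toQuaternion, polyMap]
    ring

theorem real_euler_identity {n : ℕ} {p : MvPolynomial (Fin 3) ℝ} (h : p.IsHomogeneous n) :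
    .X 0 * MvPolynomial.pderiv 0 p + .X 1 * MvPolynomial.pderiv 1 p
      + .X 2 * MvPolynomial.pderiv 2 p = (n : MvPolynomial (Fin 3) ℝ) * p := by
  rw [← nsmul_eq_mul, ← h.sum_X_mul_pderiv, Fin.sum_univ_three]

/-- The monogenic equations say that (p₀, -p₁, -p₂) is curl-free and divergence-free. Euler's
identity makes (x₀p₀ - x₁p₁ - x₂p₂)/(n + 1) an explicit potential, which is harmonic by the
divergence equation. -/
theorem mem_homMonogenic_iff {n : ℕ} {f : R3 → R3} : f ∈ homMonogenic n ↔
    ∃ u : MvPolynomial (Fin 3) ℝ, (u.IsHomogeneous (n + 1) ∧ polyLaplacian u = 0) ∧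
      f = conjGradient u := by
  constructor
  · rintro ⟨hpoly, hf⟩
    choose p hp using hpoly
    have hfp : f = polyMap p := by
      funext x
      ext i
      exact (hp i).2 x
    subst hfp
    have hcr := fun x hx => (cauchyRiemannBar_polyMap p x).symm.trans (hf x hx)
    have e0 : MvPolynomial.pderiv 0 (p 0) - .pderiv 1 (p 1) - .pderiv 2 (p 2) = 0 :=
      polynomial_eq_zero_of_evalAt_eq_zero fun x hx => congrArg QuaternionAlgebra.re (hcr x hx)
    have e1 : MvPolynomial.pderiv 0 (p 1) + .pderiv 1 (p 0) = 0 :=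
      polynomial_eq_zero_of_evalAt_eq_zero fun x hx => congrArg QuaternionAlgebra.imI (hcr x hx)
    have e2 : MvPolynomial.pderiv 0 (p 2) + .pderiv 2 (p 0) = 0 :=
      polynomial_eq_zero_of_evalAt_eq_zero fun x hx => congrArg QuaternionAlgebra.imJ (hcr x hx)
    have e3 : MvPolynomial.pderiv 1 (p 2) - .pderiv 2 (p 1) = 0 :=
      polynomial_eq_zero_of_evalAt_eq_zero fun x hx => congrArg QuaternionAlgebra.imK (hcr x hx)
    have hn : ((n : ℝ) + 1) ≠ 0 := Nat.cast_add_one_ne_zero n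
    have hinv : ∀ q : MvPolynomial (Fin 3) ℝ,
        MvPolynomial.C ((n : ℝ) + 1)⁻¹ * (((n : MvPolynomial (Fin 3) ℝ) + 1) * q) = q := by
      intro q
      have : ((n : MvPolynomial (Fin 3) ℝ) + 1) = MvPolynomial.C ((n : ℝ) + 1) := by simp
      rw [this, ← mul_assoc, ← map_mul, inv_mul_cancel₀ hn, map_one, one_mul]
    have E0 := real_euler_identity (hp 0).1
    have E1 := real_euler_identity (hp 1).1
    have E2 := real_euler_identity (hp 2).1
    set v : MvPolynomial (Fin 3) ℝ := .X 0 * p 0 - .X 1 * p 1 - .X 2 * p 2 with hv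
    have d0 : MvPolynomial.pderiv 0 v = ((n : MvPolynomial (Fin 3) ℝ) + 1) * p 0 := by
      simp [hv, MvPolynomial.pderiv_X]
      linear_combination E0 - .X 1 * e1 - .X 2 * e2
    have d1 : MvPolynomial.pderiv 1 v = ((n : MvPolynomial (Fin 3) ℝ) + 1) * (-p 1) := by
      simp [hv, MvPolynomial.pderiv_X]
      linear_combination -E1 + .X 0 * e1 - .X 2 * e3
    have d2 : MvPolynomial.pderiv 2 v = ((n : MvPolynomial (Fin 3) ℝ) + 1) * (-p 2) := by
      simp [hv, MvPolynomial.pderiv_X]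
      linear_combination -E2 + .X 0 * e2 + .X 1 * e3
    refine ⟨MvPolynomial.C ((n : ℝ) + 1)⁻¹ * v, ⟨?_, ?_⟩, ?_⟩
    · rw [add_comm n 1]
      exact ((((MvPolynomial.isHomogeneous_X _ _).mul (hp 0).1).sub
        ((MvPolynomial.isHomogeneous_X _ _).mul (hp 1).1)).sub
        ((MvPolynomial.isHomogeneous_X _ _).mul (hp 2).1)).C_mul _
    · simp only [polyLaplacian, Fin.sum_univ_three, MvPolynomial.pderiv_C_mul, d0, d1, d2]
      simp only [← MvPolynomial.pderiv_C_mul, hinv, map_neg]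
      linear_combination e0
    · funext x
      ext i
      fin_cases i <;> simp [conjGradient, polyMap, MvPolynomial.pderiv_C_mul, d0, d1, d2, -map_mul,
        -map_neg, hinv, -Derivation.leibniz]
  · rintro ⟨u, ⟨hu, hL⟩, rfl⟩
    refine ⟨fun i => ⟨_, ?_, fun x => rfl⟩, fun x _ => ?_⟩
    · fin_cases i
      · exact hu.pderiv
      · exact hu.pderiv.neg
      · exact hu.pderiv.neg
    · rw [conjGradient, cauchyRiemannBar_polyMap]
      have h0 : MvPolynomial.pderiv 0 (MvPolynomial.pderiv 0 u)
          - MvPolynomial.pderiv 1 (-MvPolynomial.pderiv 1 u)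
          - MvPolynomial.pderiv 2 (-MvPolynomial.pderiv 2 u) = 0 := by
        rw [← hL, polyLaplacian, Fin.sum_univ_three, map_neg, map_neg]
        ring
      ext
      · simp only [Matrix.cons_val_zero, Matrix.cons_val_one, Matrix.cons_val_two]
        exact (congrArg (evalAt x) h0).trans (map_zero _)
      · simp [pderiv_comm 0 1 u]
      · simp [pderiv_comm 0 2 u]
      · simp [pderiv_comm 1 2 u]

/-! ### Characterization of contragenic polynomials -/

theorem ballInner_polyMap (p q : Fin 3 → MvPolynomial (Fin 3) ℝ) :
    (ballInner (polyMap p) (polyMap q) : ℂ)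
      = ballIntegral (complexify (p 0) * complexify (q 0) + complexify (p 1) * complexify (q 1)
        + complexify (p 2) * complexify (q 2)) := by
  rw [ballInner]
  refine integral_complex_ofReal.symm.trans (MeasureTheory.integral_congr_ae
    (Filter.Eventually.of_forall fun x => ?_))
  simp only [map_add, map_mul, evalAt_complexify, PiLp.inner_apply, Fin.sum_univ_three, polyMap]
  simp [mul_comm]

/-- The map with scalar part `0` and vector part `Re H e₁ + Im H e₂`. -/
noncomputable def fieldOf (H : CPoly) (x : R3) : R3 := !₂[0, (evalAt x H).re, (evalAt x H).im]

theorem fieldOf_complexify (a b : MvPolynomial (Fin 3) ℝ) :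
    fieldOf (complexify a + MvPolynomial.C Complex.I * complexify b) = polyMap ![0, a, b] := by
  funext x
  rw [fieldOf, map_add, map_mul, evalAt_complexify, evalAt_complexify, evalAt_C]
  ext i
  fin_cases i <;> simp [polyMap]

theorem conjPoly_complexify_add (a b : MvPolynomial (Fin 3) ℝ) :
    conjPoly (complexify a + MvPolynomial.C Complex.I * complexify b)
      = complexify a - MvPolynomial.C Complex.I * complexify b := by
  rw [map_add, map_mul, conjPoly_complexify, conjPoly_complexify, conjPoly_C, Complex.conj_I,
    map_neg]
  ring

/-- The pointwise inner product of two vector parts is Re(H Ḡ). -/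
theorem ballInner_fieldOf (H G : CPoly) :
    2 * (ballInner (fieldOf H) (fieldOf G) : ℂ)
      = ballIntegral (H * conjPoly G) + ballIntegral (conjPoly H * G) := by
  obtain ⟨a, b, rfl⟩ := exists_complexify_add_I_mul H
  obtain ⟨a', b', rfl⟩ := exists_complexify_add_I_mul G
  rw [fieldOf_complexify, fieldOf_complexify, ballInner_polyMap, conjPoly_complexify_add,
    conjPoly_complexify_add, ← map_add, ← ballIntegral_C_mul]
  congr 1
  simp only [Matrix.cons_val_zero, Matrix.cons_val_one, Matrix.cons_val_two, map_zero, zero_mul,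
    Matrix.tail_cons, Matrix.head_cons, map_ofNat]
  linear_combination (2 * complexify b * complexify b') * C_I_mul_C_I

theorem mul_derivDBar_add_conj_mul_derivD (a b : MvPolynomial (Fin 3) ℝ) (w : CPoly) :
    (complexify a + MvPolynomial.C Complex.I * complexify b) * derivDBar w
      + conjPoly (complexify a + MvPolynomial.C Complex.I * complexify b) * derivD w
    = MvPolynomial.C 2 * (complexify a * MvPolynomial.pderiv 1 w
      + complexify b * MvPolynomial.pderiv 2 w) := by
  rw [conjPoly_complexify_add, derivD_apply, derivDBar_apply, map_ofNat]
  linear_combination (-2 * complexify b * MvPolynomial.pderiv 2 w) * C_I_mul_C_I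

theorem conjR3_conjGradient (u : MvPolynomial (Fin 3) ℝ) :
    (fun x => conjR3 (conjGradient u x))
      = polyMap ![MvPolynomial.pderiv 0 u, MvPolynomial.pderiv 1 u, MvPolynomial.pderiv 2 u] := by
  funext x
  ext i
  fin_cases i <;> simp [conjR3, conjGradient, polyMap]

theorem mem_homAmbigenic_iff {n : ℕ} {f : R3 → R3} : f ∈ homAmbigenic n ↔
    ∃ u v : MvPolynomial (Fin 3) ℝ, (u.IsHomogeneous (n + 1) ∧ polyLaplacian u = 0) ∧
      (v.IsHomogeneous (n + 1) ∧ polyLaplacian v = 0) ∧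
      f = polyMap ![MvPolynomial.pderiv 0 (v + u), MvPolynomial.pderiv 1 (v - u),
        MvPolynomial.pderiv 2 (v - u)] := by
  have key : ∀ u v : MvPolynomial (Fin 3) ℝ,
      (fun x => conjGradient u x + conjR3 (conjGradient v x))
        = polyMap ![MvPolynomial.pderiv 0 (v + u), MvPolynomial.pderiv 1 (v - u),
        MvPolynomial.pderiv 2 (v - u)] := by
    intro u v
    funext x
    have := congrFun (conjR3_conjGradient v) x
    rw [this]
    ext i
    fin_cases i <;> simp [conjGradient, polyMap] <;> ring
  constructor
  · rintro ⟨g, hg, h, hh, rfl⟩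
    obtain ⟨u, hu, rfl⟩ := mem_homMonogenic_iff.1 hg
    obtain ⟨v, hv, rfl⟩ := mem_homMonogenic_iff.1 hh
    exact ⟨u, v, hu, hv, key u v⟩
  · rintro ⟨u, v, hu, hv, rfl⟩
    exact ⟨_, mem_homMonogenic_iff.2 ⟨u, hu, rfl⟩, _, mem_homMonogenic_iff.2 ⟨v, hv, rfl⟩,
      (key u v).symm⟩

/-- Ambigenic maps have scalar part ∂₀(v + u) and vector part the (x₁, x₂)-gradient of v - u, where
u and v are independent. So orthogonality splits into a scalar and a vector condition; since ∂₀ is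
onto the harmonic polynomials, the first kills the scalar part. -/
theorem mem_homContragenic_iff {n : ℕ} {h : R3 → R3} : h ∈ homContragenic n ↔
    ∃ H ∈ harmonicSubmodule n, h = fieldOf H ∧ ∀ w ∈ harmonicSubmodule (n + 1),
      ballIntegral (H * derivDBar w + conjPoly H * derivD w) = 0 := by
  constructor
  · rintro ⟨hh, horth⟩
    obtain ⟨p, hp, rfl⟩ := mem_homHarmonic_iff.1 hh
    have hneg : ∀ u : MvPolynomial (Fin 3) ℝ,
        (u.IsHomogeneous (n + 1) ∧ polyLaplacian u = 0) →
        ((-u).IsHomogeneous (n + 1) ∧ polyLaplacian (-u) = 0) := fun u hu => by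
      refine ⟨hu.1.neg, ?_⟩
      have : polyLaplacian (-u) = -polyLaplacian u := by simp [polyLaplacian]
      rw [this, hu.2, neg_zero]
    have hC2 : (MvPolynomial.C 2 : CPoly) = 2 := map_ofNat _ 2
    have hscal : ∀ u : MvPolynomial (Fin 3) ℝ,
        (u.IsHomogeneous (n + 1) ∧ polyLaplacian u = 0) →
        ballIntegral (complexify (p 0) * MvPolynomial.pderiv 0 (complexify u)) = 0 := by
      intro u hu
      -- Equal potentials isolate the scalar part.
      have := horth _ (mem_homAmbigenic_iff.2 ⟨u, u, hu, hu, rfl⟩)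
      have h2 := ballInner_polyMap ![MvPolynomial.pderiv 0 (u + u), MvPolynomial.pderiv 1 (u - u),
        MvPolynomial.pderiv 2 (u - u)] p
      rw [this] at h2
      simp only [Matrix.cons_val_zero, Matrix.cons_val_one, Matrix.cons_val_two, sub_self, map_zero,
        zero_mul, add_zero, Matrix.tail_cons, Matrix.head_cons, map_add, Complex.ofReal_zero,
        ← pderiv_complexify, add_mul] at h2
      rw [mul_comm]
      linear_combination (-1 / 2 : ℂ) * h2
    have hvect : ∀ u : MvPolynomial (Fin 3) ℝ,
        (u.IsHomogeneous (n + 1) ∧ polyLaplacian u = 0) →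
        ballIntegral (complexify (p 1) * MvPolynomial.pderiv 1 (complexify u)
          + complexify (p 2) * MvPolynomial.pderiv 2 (complexify u)) = 0 := by
      intro u hu
      -- Opposite potentials isolate the vector part.
      have := horth _ (mem_homAmbigenic_iff.2 ⟨-u, u, hneg u hu, hu, rfl⟩)
      have h2 := ballInner_polyMap ![MvPolynomial.pderiv 0 (u + -u), MvPolynomial.pderiv 1 (u - -u),
        MvPolynomial.pderiv 2 (u - -u)] p
      rw [this] at h2
      simp only [Matrix.cons_val_zero, Matrix.cons_val_one, Matrix.cons_val_two, add_neg_cancel,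
        map_zero, zero_mul, zero_add, Matrix.tail_cons, Matrix.head_cons, map_add,
        Complex.ofReal_zero, sub_neg_eq_add, ← pderiv_complexify, add_mul] at h2
      rw [mul_comm, mul_comm (complexify (p 2)), map_add]
      linear_combination (-1 / 2 : ℂ) * h2
    have hp0 : p 0 = 0 := by
      -- A harmonic x₀-primitive of the scalar part, split into real and imaginary parts, serves as
      -- test potential, giving ∫ p₀² = 0.
      obtain ⟨r, hr, hrp⟩ := exists_pderiv_zero_eq
        (complexify_mem_harmonicSubmodule (hp 0).1 (hp 0).2)
      obtain ⟨a, b, ha, hb, rfl⟩ := exists_real_harmonic_of_mem_harmonicSubmodule hr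
      apply complexify_injective
      rw [map_zero]
      apply eq_zero_of_ballIntegral_mul_conjPoly
      rw [conjPoly_complexify]
      nth_rw 2 [← hrp]
      rw [map_add, MvPolynomial.pderiv_C_mul, mul_add, mul_left_comm, map_add,
        ballIntegral_C_mul, hscal a ha, hscal b hb, mul_zero, add_zero]
    refine ⟨complexify (p 1) + MvPolynomial.C Complex.I * complexify (p 2),
      add_mem (complexify_mem_harmonicSubmodule (hp 1).1 (hp 1).2) ?_, ?_, ?_⟩
    · rw [← MvPolynomial.smul_eq_C_mul]
      exact Submodule.smul_mem _ _ (complexify_mem_harmonicSubmodule (hp 2).1 (hp 2).2)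
    · rw [fieldOf_complexify, ← hp0]
      congr 1
      ext i : 1
      fin_cases i <;> rfl
    · intro w hw
      obtain ⟨a, b, ha, hb, rfl⟩ := exists_real_harmonic_of_mem_harmonicSubmodule hw
      rw [mul_derivDBar_add_conj_mul_derivD, ballIntegral_C_mul]
      have : complexify (p 1) * MvPolynomial.pderiv 1 (complexify a
            + MvPolynomial.C Complex.I * complexify b)
          + complexify (p 2) * MvPolynomial.pderiv 2 (complexify a
            + MvPolynomial.C Complex.I * complexify b)
          = (complexify (p 1) * MvPolynomial.pderiv 1 (complexify a)
            + complexify (p 2) * MvPolynomial.pderiv 2 (complexify a))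
          + MvPolynomial.C Complex.I * (complexify (p 1) * MvPolynomial.pderiv 1 (complexify b)
            + complexify (p 2) * MvPolynomial.pderiv 2 (complexify b)) := by
        simp only [map_add, MvPolynomial.pderiv_C_mul]
        ring
      rw [this, map_add, ballIntegral_C_mul, hvect a ha, hvect b hb]
      simp
  · rintro ⟨H, hH, rfl, hw⟩
    obtain ⟨a, b, ha, hb, rfl⟩ := exists_real_harmonic_of_mem_harmonicSubmodule hH
    rw [fieldOf_complexify]
    refine ⟨mem_homHarmonic_iff.2 ⟨_, fun i => ?_, rfl⟩, fun f hf => ?_⟩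
    · fin_cases i
      · exact ⟨MvPolynomial.isHomogeneous_zero _ _ _, by simp [polyLaplacian]⟩
      · exact ha
      · exact hb
    · obtain ⟨u, v, hu, hv, rfl⟩ := mem_homAmbigenic_iff.1 hf
      have hmem : complexify (v - u) ∈ harmonicSubmodule (n + 1) := by
        rw [map_sub]
        exact sub_mem (complexify_mem_harmonicSubmodule hv.1 hv.2)
          (complexify_mem_harmonicSubmodule hu.1 hu.2)
      have h2 := hw _ hmem
      rw [mul_derivDBar_add_conj_mul_derivD, ballIntegral_C_mul] at h2
      have h3 := (mul_eq_zero.1 h2).resolve_left two_ne_zero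
      rw [← Complex.ofReal_eq_zero, ballInner_polyMap, ← h3]
      congr 1
      simp only [Matrix.cons_val_zero, Matrix.cons_val_one, Matrix.cons_val_two, map_zero,
        mul_zero, zero_add, Matrix.tail_cons, Matrix.head_cons, pderiv_complexify]
      ring

/-- It suffices to test on the spanning E_k of degree n + 1, where D and D̄ return multiples of E_k
and E_{k-2}. -/
theorem forall_harmonic_iff_forall_solidPoly {n : ℕ} (H : CPoly) :
    (∀ w ∈ harmonicSubmodule (n + 1),
      ballIntegral (H * derivDBar w + conjPoly H * derivD w) = 0) ↔
    ∀ k, (if k < 2 then 0 else ballIntegral (H * solidPoly n (k - 2)))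
      = ballIntegral (conjPoly H * solidPoly n k) := by
  have hk : ∀ k, ballIntegral (H * derivDBar (solidPoly (n + 1) k)
        + conjPoly H * derivD (solidPoly (n + 1) k))
      = (2 * ((n : ℂ) + 1)) * ((if k < 2 then 0 else ballIntegral (H * solidPoly n (k - 2)))
        - ballIntegral (conjPoly H * solidPoly n k)) := by
    intro k
    have hC : (MvPolynomial.C (2 * ((n : ℂ) + 1)) : CPoly) = 2 * ((n : CPoly) + 1) := by
      simp [map_ofNat MvPolynomial.C 2]
    have h1 : H * (2 * ((n : CPoly) + 1) * solidPoly n (k - 2))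
        = MvPolynomial.C (2 * ((n : ℂ) + 1)) * (H * solidPoly n (k - 2)) := by
      rw [hC]
      ring
    have h2 : conjPoly H * (-2 * ((n : CPoly) + 1) * solidPoly n k)
        = -(MvPolynomial.C (2 * ((n : ℂ) + 1)) * (conjPoly H * solidPoly n k)) := by
      rw [hC]
      ring
    rw [derivDBar_solidPoly, derivD_solidPoly, map_add, h2, map_neg, ballIntegral_C_mul]
    split_ifs
    · rw [mul_zero, map_zero]
      ring
    · rw [h1, ballIntegral_C_mul]
      ring
  have hn : (2 * ((n : ℂ) + 1)) ≠ 0 := mul_ne_zero two_ne_zero (Nat.cast_add_one_ne_zero n)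
  constructor
  · intro h k
    have := h _ (solidPoly_mem_harmonicSubmodule (n + 1) k)
    rw [hk] at this
    exact sub_eq_zero.1 ((mul_eq_zero.1 this).resolve_left hn)
  · intro h w hw
    have hw' := harmonicSubmodule_le_span (n + 1) hw
    clear hw
    induction hw' using Submodule.span_induction with
    | mem q hq =>
      obtain ⟨k, rfl⟩ := hq
      rw [hk, h k, sub_self, mul_zero]
    | zero => simp
    | add q q' _ _ h1 h2 =>
      have : H * derivDBar (q + q') + conjPoly H * derivD (q + q')
          = (H * derivDBar q + conjPoly H * derivD q)
            + (H * derivDBar q' + conjPoly H * derivD q') := by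
        rw [map_add, map_add]
        ring
      rw [this, map_add, h1, h2, add_zero]
    | smul c q _ h1 =>
      have : H * derivDBar (c • q) + conjPoly H * derivD (c • q)
          = c • (H * derivDBar q + conjPoly H * derivD q) := by
        rw [Derivation.map_smul, Derivation.map_smul, mul_smul_comm, mul_smul_comm, smul_add]
      rw [this, map_smul, h1, smul_zero]

/-! ### The contragenic basis polynomials -/

/-- The ratio `(n - m)(n - m + 1) / ((n + m)(n + m + 1))`. -/
noncomputable def contraRatio (n m : ℕ) : ℝ :=
  (((n : ℝ) - m) * ((n : ℝ) - m + 1)) / (((n : ℝ) + m) * ((n : ℝ) + m + 1))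

/-- The complex form `λ E_{n+1+m} ± λ̄ κ E_{n+1-m}` of a contragenic polynomial. -/
noncomputable def contraPoly (n m : ℕ) (c : ℂ) : CPoly :=
  .C c * solidPoly n (n + 1 + m)
    + .C (starRingEnd ℂ c * ((-1) ^ (m + 1) * contraRatio n m)) * solidPoly n (n + 1 - m)

theorem conjPoly_contraPoly {n m : ℕ} (h : m + 1 ≤ n) (c : ℂ) : conjPoly (contraPoly n m c) =
    .C (starRingEnd ℂ c * (-1) ^ (m + 1)) * solidPoly n (n - 1 - m)
      + .C (c * contraRatio n m) * solidPoly n (n - 1 + m) := by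
  obtain ⟨l, rfl⟩ : ∃ l, n = m + l + 1 := ⟨n - (m + 1), by omega⟩
  rw [contraPoly, map_add, map_mul, map_mul, conjPoly_C, conjPoly_C,
    conjPoly_solidPoly (by omega), conjPoly_solidPoly (by omega),
    show 2 * (m + l + 1) - (m + l + 1 + 1 + m) = m + l + 1 - 1 - m by omega,
    show 2 * (m + l + 1) - (m + l + 1 + 1 - m) = m + l + 1 - 1 + m by omega,
    show m + l + 1 + (m + l + 1 + 1 + m) = m + 1 + 2 * (m + l + 1) by omega,
    show m + l + 1 + (m + l + 1 + 1 - m) = m + 1 + 2 * (l + 1) by omega]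
  simp only [map_mul, map_pow, map_neg, map_one, Complex.conj_conj, Complex.conj_ofReal]
  have h1 : ∀ j, (-1 : CPoly) ^ (m + 1 + 2 * j) = (-1) ^ (m + 1) := fun j => by
    rw [pow_add, pow_mul]
    simp
  have h2 : (-1 : CPoly) ^ (m + 1) * (-1) ^ (m + 1) = 1 := by
    rw [← mul_pow]
    simp
  rw [h1, h1]
  linear_combination (.C c * .C (contraRatio (m + l + 1) m : ℂ)
    * solidPoly (m + l + 1) (m + l + 1 - 1 + m)) * h2

theorem ballIntegral_solidPoly_mul_eq_ite (n j k : ℕ) :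
    ballIntegral (solidPoly n j * solidPoly n k) = if j + k = 2 * n then dualPairing n k else 0 := by
  split_ifs with h
  · rw [mul_comm]
    exact ballIntegral_solidPoly_mul (by omega)
  · exact ballIntegral_solidPoly_mul_of_ne h

theorem ballIntegral_two_term_mul (n i j k : ℕ) (a b : ℂ) :
    ballIntegral ((.C a * solidPoly n i + .C b * solidPoly n j) * solidPoly n k)
      = a * (if i + k = 2 * n then dualPairing n k else 0)
        + b * (if j + k = 2 * n then dualPairing n k else 0) := by
  rw [add_mul, map_add, mul_assoc, mul_assoc, ballIntegral_C_mul, ballIntegral_C_mul,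
    ballIntegral_solidPoly_mul_eq_ite, ballIntegral_solidPoly_mul_eq_ite]

theorem contraRatio_mul {n m : ℕ} (h : m + 1 ≤ n) :
    (contraRatio n m : ℂ) * (((n : ℂ) + m) * ((n : ℂ) + m + 1))
      = ((n : ℂ) - m) * ((n : ℂ) - m + 1) := by
  have h1 : ((n : ℂ) + m) ≠ 0 := by
    norm_cast
    omega
  have h2 : ((n : ℂ) + m + 1) ≠ 0 := by
    norm_cast
  rw [contraRatio]
  push_cast
  exact div_mul_cancel₀ _ (mul_ne_zero h1 h2)

/-- The ratio κ is what two steps of the recurrence produce; `dualPairing_high` is its mirror image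
under k ↦ 2n - k. -/
theorem dualPairing_low {n m : ℕ} (h : m + 1 ≤ n) :
    dualPairing n (n - 1 - m) = contraRatio n m * dualPairing n (n + 1 - m) := by
  obtain ⟨l, rfl⟩ : ∃ l, n = m + l + 1 := ⟨n - (m + 1), by omega⟩
  have h1 := dualPairing_add_two (n := m + l + 1) (k := l) (by omega)
  have h2 := contraRatio_mul h
  rw [show m + l + 1 - 1 - m = l by omega, show m + l + 1 + 1 - m = l + 2 by omega]
  push_cast at h1 h2
  have hne : ((m : ℂ) + l + 1 + m) * ((m : ℂ) + l + 1 + m + 1) ≠ 0 := by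
    refine mul_ne_zero ?_ ?_ <;> norm_cast
    omega
  apply mul_left_cancel₀ hne
  linear_combination -h1 - dualPairing (m + l + 1) (l + 2) * h2

theorem dualPairing_high {n m : ℕ} (h : m + 1 ≤ n) :
    dualPairing n (n + 1 + m) = contraRatio n m * dualPairing n (n - 1 + m) := by
  obtain ⟨l, rfl⟩ : ∃ l, n = m + l + 1 := ⟨n - (m + 1), by omega⟩
  have h1 := dualPairing_add_two (n := m + l + 1) (k := m + l + m) (by omega)
  have h2 := contraRatio_mul h
  rw [show m + l + 1 - 1 + m = m + l + m by omega,
    show m + l + 1 + 1 + m = m + l + m + 2 by omega]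
  push_cast at h1 h2
  have hne : ((m : ℂ) + l + 1 + m) * ((m : ℂ) + l + 1 + m + 1) ≠ 0 := by
    refine mul_ne_zero ?_ ?_ <;> norm_cast
    omega
  apply mul_left_cancel₀ hne
  linear_combination h1 - dualPairing (m + l + 1) (m + l + m) * h2

theorem contraPoly_mem_harmonicSubmodule (n m : ℕ) (c : ℂ) :
    contraPoly n m c ∈ harmonicSubmodule n := by
  rw [contraPoly, ← MvPolynomial.smul_eq_C_mul, ← MvPolynomial.smul_eq_C_mul]
  exact add_mem (Submodule.smul_mem _ _ (solidPoly_mem_harmonicSubmodule _ _))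
    (Submodule.smul_mem _ _ (solidPoly_mem_harmonicSubmodule _ _))

/-- Only the test indices k = n + 1 ± m can give nonzero integrals, and there the ratio κ balances
the two pairings. -/
theorem fieldOf_contraPoly_mem {n m : ℕ} (h : m + 1 ≤ n) (c : ℂ) :
    fieldOf (contraPoly n m c) ∈ homContragenic n := by
  refine mem_homContragenic_iff.2 ⟨_, contraPoly_mem_harmonicSubmodule n m c, rfl,
    (forall_harmonic_iff_forall_solidPoly _).2 fun k => ?_⟩
  rw [conjPoly_contraPoly h, ballIntegral_two_term_mul, contraPoly, ballIntegral_two_term_mul]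
  have hlow := dualPairing_low h
  have hhigh := dualPairing_high h
  rcases lt_or_ge k 2 with hk | hk
  · rw [if_pos hk, if_neg (by omega), if_neg (by omega)]
    ring
  obtain ⟨j, rfl⟩ : ∃ j, k = j + 2 := ⟨k - 2, by omega⟩
  rw [if_neg (by omega), Nat.add_sub_cancel]
  have e1 : (if n + 1 + m + j = 2 * n then dualPairing n j else 0) = contraRatio n m
      * (if n - 1 + m + (j + 2) = 2 * n then dualPairing n (j + 2) else 0) := by
    by_cases hj : j = n - 1 - m
    · rw [if_pos (by omega), if_pos (by omega), hj, hlow, show n - 1 - m + 2 = n + 1 - m by omega]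
    · rw [if_neg (by omega), if_neg (by omega), mul_zero]
  have e2 : contraRatio n m * (if n + 1 - m + j = 2 * n then dualPairing n j else 0)
      = if n - 1 - m + (j + 2) = 2 * n then dualPairing n (j + 2) else 0 := by
    by_cases hj : j = n - 1 + m
    · rw [if_pos (by omega), if_pos (by omega), hj, show n - 1 + m + 2 = n + 1 + m by omega, hhigh]
    · rw [if_neg (by omega), if_neg (by omega), mul_zero]
  linear_combination c * e1 + starRingEnd ℂ c * (-1) ^ (m + 1) * e2

/-- The test conditions are linear relations between a_{2n+2-k} and the conjugate of a_k, so the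
coefficients pair off symmetrically about the index n + 1. -/
theorem exists_eq_sum_contraPoly {n : ℕ} {H : CPoly} (hn : 1 ≤ n) (hH : H ∈ harmonicSubmodule n)
    (hw : ∀ k, (if k < 2 then 0 else ballIntegral (H * solidPoly n (k - 2)))
      = ballIntegral (conjPoly H * solidPoly n k)) :
    ∃ c : ℕ → ℂ, H = ∑ m ∈ Finset.range n, contraPoly n m (c m) := by
  obtain ⟨a, rfl⟩ : ∃ a : ℕ → ℂ,
      H = ∑ k ∈ Finset.range (2 * n + 1), .C (a k) * solidPoly n k := by
    have hH' := harmonicSubmodule_le_span n hH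
    clear hH hw
    induction hH' using Submodule.span_induction with
    | mem q hq =>
      obtain ⟨k, rfl⟩ := hq
      by_cases hk : k ≤ 2 * n
      · refine ⟨Pi.single k 1, ?_⟩
        rw [Finset.sum_eq_single_of_mem k (Finset.mem_range.2 (by omega))]
        · simp
        · intro b _ hb
          simp [Pi.single_eq_of_ne hb]
      · exact ⟨0, by simp [solidPoly_of_lt (not_le.1 hk)]⟩
    | zero => exact ⟨0, by simp⟩
    | add q q' _ _ h1 h2 =>
      obtain ⟨a, rfl⟩ := h1
      obtain ⟨b, rfl⟩ := h2
      exact ⟨a + b, by simp [add_mul, Finset.sum_add_distrib]⟩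
    | smul c q _ h1 =>
      obtain ⟨a, rfl⟩ := h1
      exact ⟨c • a, by simp [MvPolynomial.smul_eq_C_mul, Finset.mul_sum, mul_assoc]⟩
  have hI : ∀ j, j ≤ 2 * n → ballIntegral
      ((∑ k ∈ Finset.range (2 * n + 1), .C (a k) * solidPoly n k) * solidPoly n j)
        = a (2 * n - j) * dualPairing n j := by
    intro j hj
    rw [Finset.sum_mul, map_sum, Finset.sum_eq_single_of_mem (2 * n - j)
      (Finset.mem_range.2 (by omega))]
    · rw [mul_assoc, ballIntegral_C_mul, ballIntegral_solidPoly_mul_eq_ite, if_pos (by omega)]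
    · intro b _ hb
      rw [mul_assoc, ballIntegral_C_mul, ballIntegral_solidPoly_mul_eq_ite, if_neg (by omega),
        mul_zero]
  have hIc : ∀ j, j ≤ 2 * n → ballIntegral
      (conjPoly (∑ k ∈ Finset.range (2 * n + 1), .C (a k) * solidPoly n k) * solidPoly n j)
        = starRingEnd ℂ (a j) * (-1) ^ (n + j) * dualPairing n j := by
    intro j hj
    have hterm : ∀ k ∈ Finset.range (2 * n + 1),
        ballIntegral (conjPoly (.C (a k) * solidPoly n k) * solidPoly n j)
          = if k = j then starRingEnd ℂ (a j) * (-1) ^ (n + j) * dualPairing n j else 0 := by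
      intro k hk
      rw [Finset.mem_range] at hk
      rw [conjPoly.map_mul, conjPoly_C, conjPoly_solidPoly (by omega),
        show (MvPolynomial.C (starRingEnd ℂ (a k)) * ((-1) ^ (n + k) * solidPoly n (2 * n - k))
          * solidPoly n j : CPoly) = .C (starRingEnd ℂ (a k) * (-1) ^ (n + k))
            * (solidPoly n (2 * n - k) * solidPoly n j) by simp; ring, ballIntegral_C_mul,
        ballIntegral_solidPoly_mul_eq_ite]
      by_cases hkj : k = j
      · rw [if_pos (by omega), if_pos hkj, hkj]
      · rw [if_neg (by omega), if_neg hkj, mul_zero]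
    rw [map_sum, Finset.sum_mul, map_sum, Finset.sum_congr rfl hterm, Finset.sum_ite_eq',
      if_pos (Finset.mem_range.2 (by omega))]
  -- The tests k = 0, 1 have no D̄ term.
  have hsmall : ∀ j, j < 2 → a j = 0 := by
    intro j hj
    have := hw j
    rw [if_pos hj, hIc j (by omega)] at this
    have h2 := (mul_eq_zero.1 this.symm).resolve_right (dualPairing_ne_zero (by omega))
    simpa using (mul_eq_zero.1 h2).resolve_right (pow_ne_zero _ (by norm_num))
  -- The test k = n + 1 - m; for m = 0 it makes a_{n+1} purely imaginary.
  have hrel : ∀ m, m + 1 ≤ n →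
      a (n + 1 - m) = starRingEnd ℂ (a (n + 1 + m)) * ((-1) ^ (m + 1) * contraRatio n m) := by
    intro m hm
    have h1 := hw (n + 1 - m)
    rw [if_neg (by omega), hI _ (by omega), hIc _ (by omega),
      show n + 1 - m - 2 = n - 1 - m by omega, dualPairing_low hm,
      show 2 * n - (n - 1 - m) = n + 1 + m by omega, ← mul_assoc] at h1
    have h2 := mul_right_cancel₀ (dualPairing_ne_zero (by omega)) h1
    have h3 := congrArg (starRingEnd ℂ) h2
    simp only [map_mul, map_pow, map_neg, map_one, Complex.conj_conj, Complex.conj_ofReal] at h3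
    rw [show n + (n + 1 - m) = m + 1 + 2 * (n - m) by omega, pow_add, pow_mul] at h3
    have h4 : (-1 : ℂ) ^ (m + 1) * (-1) ^ (m + 1) = 1 := by
      rw [← mul_pow]
      simp
    simp only [even_two, Even.neg_pow, one_pow, mul_one] at h3
    linear_combination (-(-1) ^ (m + 1)) * h3 - a (n + 1 - m) * h4
  obtain ⟨N, rfl⟩ : ∃ N, n = N + 1 := ⟨n - 1, by omega⟩
  -- At m = 0 both terms of the block fall on the index n + 1 and add up to c minus its conjugate,
  -- which doubles an imaginary c; hence the half.
  refine ⟨fun m => if m = 0 then a (N + 1 + 1 + m) / 2 else a (N + 1 + 1 + m), ?_⟩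
  have h0 : contraPoly (N + 1) 0 (a (N + 1 + 1 + 0) / 2)
      = .C (a (N + 2)) * solidPoly (N + 1) (N + 2) := by
    have h1 := hrel 0 (by omega)
    have hr : contraRatio (N + 1) 0 = 1 := by
      rw [contraRatio]
      push_cast
      rw [sub_zero, add_zero, div_self]
      positivity
    rw [hr] at h1
    rw [contraPoly, hr, show N + 1 + 1 - 0 = N + 1 + 1 + 0 by omega, ← add_mul, ← map_add]
    congr 2
    simp [map_ofNat] at h1 ⊢
    linear_combination (-1 / 2 : ℂ) * h1
  have hm : ∀ m, m < N → contraPoly (N + 1) (m + 1) (a (N + 1 + 1 + (m + 1)))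
      = .C (a (N + 3 + m)) * solidPoly (N + 1) (N + 3 + m)
        + .C (a (N - 1 - m + 2)) * solidPoly (N + 1) (N - 1 - m + 2) := by
    intro m hm
    have h1 := hrel (m + 1) (by omega)
    rw [contraPoly, ← h1, show N + 1 + 1 + (m + 1) = N + 3 + m by omega,
      show N + 1 + 1 - (m + 1) = N - 1 - m + 2 by omega]
  -- Splits the sum at the centre N + 2 = n + 1 into the indices below, above and at it.
  have hshift : ∀ g : ℕ → CPoly, g 0 = 0 → g 1 = 0 →
      ∑ k ∈ Finset.range (2 * (N + 1) + 1), g k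
        = ∑ k ∈ Finset.range N, g (k + 2)
          + (∑ k ∈ Finset.range N, g (N + 3 + k) + g (N + 2)) := by
    intro g hg0 hg1
    rw [show 2 * (N + 1) + 1 = (N + (N + 1)) + 1 + 1 by ring, Finset.sum_range_succ',
      Finset.sum_range_succ', hg0, hg1, add_zero, add_zero, Finset.sum_range_add,
      Finset.sum_range_succ' _ N]
    congr 2
    exact Finset.sum_congr rfl fun k _ => congrArg g (by omega)
  rw [hshift _ (by rw [hsmall 0 (by norm_num), map_zero, zero_mul])
      (by rw [hsmall 1 (by norm_num), map_zero, zero_mul]), Finset.sum_range_succ' _ N]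
  simp only [Nat.succ_ne_zero, if_true, if_false]
  rw [h0, Finset.sum_congr rfl fun m hmem => hm m (Finset.mem_range.1 hmem),
    Finset.sum_add_distrib,
    Finset.sum_range_reflect (fun k => .C (a (k + 2)) * solidPoly (N + 1) (k + 2)) N]
  ring

/-! ### Orthogonality and nonvanishing of the blocks -/

theorem contraPoly_mul_conjPoly {n m m' : ℕ} (h' : m' + 1 ≤ n) (c c' : ℂ) :
    ballIntegral (contraPoly n m c * conjPoly (contraPoly n m' c')) =
      starRingEnd ℂ c' * (-1) ^ (m' + 1)
        * ballIntegral (contraPoly n m c * solidPoly n (n - 1 - m'))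
      + c' * contraRatio n m' * ballIntegral (contraPoly n m c * solidPoly n (n - 1 + m')) := by
  rw [conjPoly_contraPoly h', mul_add, map_add, mul_left_comm, mul_left_comm _ (MvPolynomial.C _),
    ballIntegral_C_mul, ballIntegral_C_mul]

theorem contraPoly_mul_conjPoly_of_ne {n m m' : ℕ} (h : m + 1 ≤ n) (h' : m' + 1 ≤ n) (hne : m ≠ m')
    (c c' : ℂ) : ballIntegral (contraPoly n m c * conjPoly (contraPoly n m' c')) = 0 := by
  rw [contraPoly_mul_conjPoly h', contraPoly, ballIntegral_two_term_mul, ballIntegral_two_term_mul,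
    if_neg (by omega), if_neg (by omega), if_neg (by omega), if_neg (by omega)]
  ring

theorem contraPoly_mul_conjPoly_self {n m : ℕ} (h : m + 1 ≤ n) (hm : m ≠ 0) (c c' : ℂ) :
    ballIntegral (contraPoly n m c * conjPoly (contraPoly n m c')) =
      c * starRingEnd ℂ c' * ((-1) ^ (m + 1) * dualPairing n (n - 1 - m))
      + starRingEnd ℂ c * c'
        * ((-1) ^ (m + 1) * contraRatio n m ^ 2 * dualPairing n (n - 1 + m)) := by
  rw [contraPoly_mul_conjPoly h, contraPoly, ballIntegral_two_term_mul, ballIntegral_two_term_mul,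
    if_pos (by omega), if_neg (by omega), if_neg (by omega), if_pos (by omega)]
  ring

theorem ballInner_contraPoly_of_ne {n m m' : ℕ} (h : m + 1 ≤ n) (h' : m' + 1 ≤ n) (hne : m ≠ m')
    (c c' : ℂ) :
    ballInner (fieldOf (contraPoly n m c)) (fieldOf (contraPoly n m' c')) = 0 := by
  have h2 := ballInner_fieldOf (contraPoly n m c) (contraPoly n m' c')
  rw [mul_comm (conjPoly _), contraPoly_mul_conjPoly_of_ne h h' hne,
    contraPoly_mul_conjPoly_of_ne h' h hne.symm, add_zero] at h2
  exact_mod_cast (mul_eq_zero.1 h2).resolve_left two_ne_zero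

/-- The hypothesis says that c and c' are perpendicular in the plane; after symmetrization it is a
common factor of the whole inner product. -/
theorem ballInner_contraPoly_self {n m : ℕ} (h : m + 1 ≤ n) (hm : m ≠ 0) {c c' : ℂ}
    (hc : c * starRingEnd ℂ c' + starRingEnd ℂ c * c' = 0) :
    ballInner (fieldOf (contraPoly n m c)) (fieldOf (contraPoly n m c')) = 0 := by
  have h2 := ballInner_fieldOf (contraPoly n m c) (contraPoly n m c')
  rw [mul_comm (conjPoly _), contraPoly_mul_conjPoly_self h hm,
    contraPoly_mul_conjPoly_self h hm] at h2
  have h3 : 2 * (ballInner (fieldOf (contraPoly n m c)) (fieldOf (contraPoly n m c')) : ℂ) = 0 := by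
    rw [h2]
    linear_combination ((-1) ^ (m + 1) * dualPairing n (n - 1 - m)
      + (-1) ^ (m + 1) * contraRatio n m ^ 2 * dualPairing n (n - 1 + m)) * hc
  exact_mod_cast (mul_eq_zero.1 h3).resolve_left two_ne_zero

theorem contraPoly_ne_zero {n m : ℕ} (h : m + 1 ≤ n) (hm : m ≠ 0) {c : ℂ} (hc : c ≠ 0) :
    contraPoly n m c ≠ 0 := by
  intro h0
  have h2 := ballIntegral_two_term_mul n (n + 1 + m) (n + 1 - m) (n - 1 - m) c
    (starRingEnd ℂ c * ((-1) ^ (m + 1) * contraRatio n m))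
  rw [← contraPoly, h0, zero_mul, map_zero, if_pos (by omega), if_neg (by omega), mul_zero,
    add_zero] at h2
  exact mul_ne_zero hc (dualPairing_ne_zero (by omega)) h2.symm

theorem contraRatio_zero {n : ℕ} (hn : 1 ≤ n) : contraRatio n 0 = 1 := by
  have : (n : ℝ) ≠ 0 := by
    norm_cast
    omega
  rw [contraRatio, Nat.cast_zero, sub_zero, add_zero, div_self]
  positivity

theorem contraPoly_zero {n : ℕ} (hn : 1 ≤ n) (c : ℂ) :
    contraPoly n 0 c = .C (c - starRingEnd ℂ c) * solidPoly n (n + 1) := by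
  rw [contraPoly, contraRatio_zero hn, Nat.sub_zero, Nat.add_zero, ← add_mul, ← map_add]
  congr 2
  push_cast
  ring

theorem contraPoly_zero_ne_zero {n : ℕ} (hn : 1 ≤ n) {c : ℂ} (hc : c - starRingEnd ℂ c ≠ 0) :
    contraPoly n 0 c ≠ 0 := by
  intro h0
  have h2 := congrArg (fun p => ballIntegral (p * solidPoly n (n - 1))) h0
  simp only [contraPoly_zero hn, mul_assoc, ballIntegral_C_mul, zero_mul, map_zero] at h2
  rw [ballIntegral_solidPoly_mul (by omega)] at h2
  exact mul_ne_zero hc (dualPairing_ne_zero (by omega)) h2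

theorem contraPoly_add (n m : ℕ) (c c' : ℂ) :
    contraPoly n m (c + c') = contraPoly n m c + contraPoly n m c' := by
  simp only [contraPoly, map_add, add_mul]
  ring

theorem contraPoly_real_mul (n m : ℕ) (r : ℝ) (c : ℂ) :
    contraPoly n m (r * c) = .C (r : ℂ) * contraPoly n m c := by
  simp only [contraPoly, map_mul, Complex.conj_ofReal]
  ring

theorem fieldOf_add (H G : CPoly) : fieldOf (H + G) = fieldOf H + fieldOf G := by
  funext x
  ext i
  fin_cases i <;> simp [fieldOf]

theorem fieldOf_real_mul (r : ℝ) (H : CPoly) : fieldOf (.C (r : ℂ) * H) = r • fieldOf H := by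
  funext x
  ext i
  fin_cases i <;> simp [fieldOf, evalAt_C]

theorem fieldOf_zero : fieldOf 0 = 0 := by
  funext x
  ext i
  fin_cases i <;> simp [fieldOf]

theorem fieldOf_sum {ι : Type*} (s : Finset ι) (H : ι → CPoly) :
    fieldOf (∑ i ∈ s, H i) = ∑ i ∈ s, fieldOf (H i) := by
  classical
  induction s using Finset.induction_on with
  | empty => simp [fieldOf_zero]
  | insert i s hi ih => rw [Finset.sum_insert hi, Finset.sum_insert hi, fieldOf_add, ih]

theorem eq_zero_of_fieldOf_eq_zero {H : CPoly} (h : fieldOf H = 0) : H = 0 := by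
  refine eq_zero_of_evalAt_eq_zero fun x _ => ?_
  have hx := congrFun h x
  apply Complex.ext
  · simpa [fieldOf] using congrArg (fun v : R3 => v 1) hx
  · simpa [fieldOf] using congrArg (fun v : R3 => v 2) hx

/-! ### The functions `Z` in terms of the basis polynomials -/

theorem rodriguesFactor_pos (n m : ℕ) : 0 < rodriguesFactor n m := by
  rw [rodriguesFactor]
  positivity

/-- The lower term E_{n-m} is ± the conjugate of E_{n+m}, so the block combines U and V of orders m
+ 2 and m, as in Z. -/
theorem evalAt_contraPoly {n m : ℕ} (h : m + 1 < n) (ε : ℂ) (x : R3) :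
    evalAt x (contraPoly n (m + 1) (rodriguesFactor n (m + 2) * ε))
      = ε * ((solidU n (m + 2) x : ℂ) + solidV n (m + 2) x * Complex.I)
        + starRingEnd ℂ ε * (dCoeff n (m + 1) * (solidU n m x - solidV n m x * Complex.I)) := by
  have h1 := solidU_add_solidV_mul_I (n := n) (by omega) (m + 2) x
  have h2 := congrArg (starRingEnd ℂ) (solidU_add_solidV_mul_I (n := n) (by omega) m x)
  simp only [map_add, map_mul, Complex.conj_ofReal, Complex.conj_I] at h2
  rw [← evalAt_conjPoly, conjPoly_solidPoly (by omega),
    show n + (n + m) = m + 2 * n by omega, show 2 * n - (n + m) = n + 1 - (m + 1) by omega,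
    pow_add, pow_mul] at h2
  simp only [even_two, Even.neg_pow, one_pow, mul_one, map_mul, map_pow, map_neg, map_one] at h2
  -- Raising the order by two multiplies the Rodrigues factor by (n + m + 1)(n + m + 2), the
  -- denominator of κ; its numerator is d.
  have hd : (dCoeff n (m + 1) : ℂ) * rodriguesFactor n m
      = rodriguesFactor n (m + 2) * contraRatio n (m + 1) := by
    have hr := contraRatio_mul (n := n) (m := m + 1) (by omega)
    have hw : (rodriguesFactor n (m + 2) : ℂ)
        = rodriguesFactor n m * (((n : ℂ) + m + 1) * ((n : ℂ) + m + 2)) := by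
      rw [rodriguesFactor, rodriguesFactor, ← add_assoc, Nat.factorial_succ, Nat.factorial_succ]
      push_cast
      ring
    rw [hw, dCoeff]
    push_cast at hr ⊢
    linear_combination (-(rodriguesFactor n m : ℂ)) * hr
  rw [contraPoly, map_add, (evalAt x).map_mul, (evalAt x).map_mul, evalAt_C, evalAt_C, map_mul,
    Complex.conj_ofReal, show n + 1 + (m + 1) = n + (m + 2) by omega]
  linear_combination (-ε) * h1 - starRingEnd ℂ ε * dCoeff n (m + 1) * h2
    - starRingEnd ℂ ε * (-1) ^ m * evalAt x (solidPoly n (n + 1 - (m + 1))) * hd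

theorem Zminus_eq {n m : ℕ} (h : m + 1 < n) :
    Zminus n (m + 1) = fieldOf (contraPoly n (m + 1) (rodriguesFactor n (m + 2) * 1)) := by
  funext x
  rw [fieldOf, evalAt_contraPoly h]
  ext i
  fin_cases i <;> simp [Zminus] <;> ring

theorem Zplus_eq {n m : ℕ} (h : m + 1 < n) :
    Zplus n (m + 1) = fieldOf (contraPoly n (m + 1) (rodriguesFactor n (m + 2) * -Complex.I)) := by
  funext x
  rw [fieldOf, evalAt_contraPoly h]
  ext i
  fin_cases i <;> simp [Zplus] <;> ring

theorem Zzero_eq {n : ℕ} (hn : 1 ≤ n) :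
    Zzero n = fieldOf (contraPoly n 0 (rodriguesFactor n 1 * (-Complex.I / 2))) := by
  funext x
  have h1 := solidU_add_solidV_mul_I hn 1 x
  have h2 : evalAt x (contraPoly n 0 (rodriguesFactor n 1 * (-Complex.I / 2)))
      = -Complex.I * ((solidU n 1 x : ℂ) + solidV n 1 x * Complex.I) := by
    rw [contraPoly_zero hn, map_mul, evalAt_C, h1, map_mul, Complex.conj_ofReal, map_div₀, map_neg,
      Complex.conj_I, map_ofNat]
    ring
  rw [fieldOf, h2]
  ext i
  fin_cases i <;> simp [Zzero]

/-- The parameters `m` and `λ` of the members of the family `Z`. -/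
noncomputable def zParam (n : ℕ) : ZIndex n → ℕ × ℂ
  | Sum.inl _ => (0, rodriguesFactor n 1 * (-Complex.I / 2))
  | Sum.inr (Sum.inl m) => (m, rodriguesFactor n (m + 1) * -Complex.I)
  | Sum.inr (Sum.inr m) => (m, rodriguesFactor n (m + 1) * 1)

theorem zParam_lt {n : ℕ} (hn : 1 ≤ n) (i : ZIndex n) : (zParam n i).1 + 1 ≤ n := by
  rcases i with _ | ⟨m, hm⟩ | ⟨m, hm⟩
  · exact hn
  all_goals
    rw [Finset.mem_Icc] at hm
    simp only [zParam]
    omega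

theorem Zfamily_eq {n : ℕ} (hn : 1 ≤ n) (i : ZIndex n) :
    Zfamily n i = fieldOf (contraPoly n (zParam n i).1 (zParam n i).2) := by
  rcases i with _ | ⟨m, hm⟩ | ⟨m, hm⟩
  · exact Zzero_eq hn
  all_goals
    rw [Finset.mem_Icc] at hm
    obtain ⟨k, rfl⟩ : ∃ k, m = k + 1 := ⟨m - 1, by omega⟩
  · exact Zplus_eq (by omega)
  · exact Zminus_eq (by omega)

theorem contraPoly_zParam_ne_zero {n : ℕ} (hn : 1 ≤ n) (i : ZIndex n) :
    contraPoly n (zParam n i).1 (zParam n i).2 ≠ 0 := by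
  have hw : ∀ m, (rodriguesFactor n m : ℂ) ≠ 0 := fun m => by
    exact_mod_cast (rodriguesFactor_pos n m).ne'
  rcases i with _ | ⟨m, hm⟩ | ⟨m, hm⟩
  · refine contraPoly_zero_ne_zero hn ?_
    simp only [zParam]
    rw [map_mul, Complex.conj_ofReal, map_div₀, map_neg, Complex.conj_I, map_ofNat, ← mul_sub]
    refine mul_ne_zero (hw 1) ?_
    rw [show -Complex.I / 2 - - -Complex.I / 2 = -Complex.I by ring]
    exact neg_ne_zero.2 Complex.I_ne_zero
  all_goals
    rw [Finset.mem_Icc] at hm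
    refine contraPoly_ne_zero (m := m) (by omega) (by omega) (mul_ne_zero (hw _) ?_)
  · exact neg_ne_zero.2 Complex.I_ne_zero
  · exact one_ne_zero

/-! ### Orthogonality, independence and span of the family -/

theorem ballInner_Zfamily_of_ne {n : ℕ} (hn : 1 ≤ n) {i j : ZIndex n} (hij : i ≠ j) :
    ballInner (Zfamily n i) (Zfamily n j) = 0 := by
  rw [Zfamily_eq hn, Zfamily_eq hn]
  by_cases hm : (zParam n i).1 = (zParam n j).1
  · rw [hm]
    have hj := zParam_lt hn j
    rcases i with _ | ⟨m, hmi⟩ | ⟨m, hmi⟩ <;> rcases j with _ | ⟨m', hmj⟩ | ⟨m', hmj⟩ <;>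
      simp only [zParam] at hm hj ⊢
    · exact absurd rfl hij
    · exact absurd (hm ▸ (Finset.mem_Icc.1 hmj).1) (by norm_num)
    · exact absurd (hm ▸ (Finset.mem_Icc.1 hmj).1) (by norm_num)
    · exact absurd (hm ▸ (Finset.mem_Icc.1 hmi).1) (by norm_num)
    · subst hm
      exact absurd rfl hij
    · subst hm
      refine ballInner_contraPoly_self hj (Nat.one_le_iff_ne_zero.1 (Finset.mem_Icc.1 hmi).1) ?_
      simp
    · exact absurd (hm ▸ (Finset.mem_Icc.1 hmi).1) (by norm_num)
    · subst hm
      refine ballInner_contraPoly_self hj (Nat.one_le_iff_ne_zero.1 (Finset.mem_Icc.1 hmi).1) ?_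
      simp
    · subst hm
      exact absurd rfl hij
  · exact ballInner_contraPoly_of_ne (zParam_lt hn i) (zParam_lt hn j) hm _ _

/-- Pairing a vanishing combination with the j-th member leaves its coefficient times 2∫ |T_j|²,
which is nonzero. -/
theorem linearIndependent_Zfamily {n : ℕ} (hn : 1 ≤ n) : LinearIndependent ℝ (Zfamily n) := by
  rw [Fintype.linearIndependent_iff]
  intro g hg j
  set T : ZIndex n → CPoly := fun i => contraPoly n (zParam n i).1 (zParam n i).2 with hT
  have hZ : ∀ i, Zfamily n i = fieldOf (T i) := Zfamily_eq hn
  have hS : ∑ i, (.C (g i : ℂ) * T i : CPoly) = 0 := by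
    apply eq_zero_of_fieldOf_eq_zero
    rw [fieldOf_sum, ← hg]
    exact Finset.sum_congr rfl fun i _ => by rw [fieldOf_real_mul, hZ]
  have h1 : ∑ i, (g i : ℂ) * (ballIntegral (T i * conjPoly (T j))
      + ballIntegral (conjPoly (T i) * T j)) = 0 := by
    have e1 : ∑ i, (g i : ℂ) * ballIntegral (T i * conjPoly (T j)) = 0 := by
      simp only [← ballIntegral_C_mul, ← mul_assoc]
      rw [← map_sum, ← Finset.sum_mul, hS, zero_mul, map_zero]
    have e2 : ∑ i, (g i : ℂ) * ballIntegral (conjPoly (T i) * T j) = 0 := by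
      have := congrArg conjPoly hS
      simp only [map_sum, map_zero, map_mul conjPoly, conjPoly_C, Complex.conj_ofReal] at this
      simp only [← ballIntegral_C_mul, ← mul_assoc]
      rw [← map_sum, ← Finset.sum_mul, this, zero_mul, map_zero]
    simp only [mul_add, Finset.sum_add_distrib, e1, e2, add_zero]
  rw [Finset.sum_eq_single_of_mem j (Finset.mem_univ j)] at h1
  · rw [mul_comm (conjPoly _)] at h1
    have h2 : ballIntegral (T j * conjPoly (T j)) ≠ 0 := fun h0 =>
      contraPoly_zParam_ne_zero hn j (eq_zero_of_ballIntegral_mul_conjPoly h0)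
    rw [← two_mul] at h1
    exact_mod_cast (mul_eq_zero.1 h1).resolve_right (mul_ne_zero two_ne_zero h2)
  · intro i _ hij
    rw [← ballInner_fieldOf, ← hZ, ← hZ, ballInner_Zfamily_of_ne hn hij]
    simp

/-- A block is real-linear in c, and 1 and -i span ℂ over ℝ; for m = 0 only the imaginary part of c
matters. -/
theorem fieldOf_contraPoly_mem_span {n m : ℕ} (h : m + 1 ≤ n) (c : ℂ) :
    fieldOf (contraPoly n m c) ∈ Submodule.span ℝ (Set.range (Zfamily n)) := by
  have hn : 1 ≤ n := by omega
  have hw : ∀ k, (rodriguesFactor n k : ℂ) ≠ 0 := fun k => by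
    exact_mod_cast (rodriguesFactor_pos n k).ne'
  rcases m with _ | m
  · have hc : contraPoly n 0 c = .C ((-2 * c.im / rodriguesFactor n 1 : ℝ) : ℂ)
        * contraPoly n 0 (rodriguesFactor n 1 * (-Complex.I / 2)) := by
      rw [← contraPoly_real_mul, contraPoly_zero hn, contraPoly_zero hn]
      congr 2
      have := hw 1
      have him : c - starRingEnd ℂ c = (2 * c.im : ℝ) * Complex.I := Complex.sub_conj c
      rw [him, Complex.sub_conj]
      congr 2
      have h1 := (rodriguesFactor_pos n 1).ne'
      simp
      field_simp
    rw [hc, fieldOf_real_mul, ← Zzero_eq hn]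
    exact Submodule.smul_mem _ _ (Submodule.subset_span ⟨Sum.inl (), rfl⟩)
  · have hmem : m + 1 ∈ Finset.Icc 1 (n - 1) := Finset.mem_Icc.2 ⟨by omega, by omega⟩
    have hc : c = ((c.re / rodriguesFactor n (m + 2) : ℝ) : ℂ) * (rodriguesFactor n (m + 2) * 1)
        + ((-c.im / rodriguesFactor n (m + 2) : ℝ) : ℂ)
          * (rodriguesFactor n (m + 2) * -Complex.I) := by
      have := hw (m + 2)
      conv_lhs => rw [← Complex.re_add_im c]
      push_cast
      field_simp
    rw [hc, contraPoly_add, contraPoly_real_mul _ _ (c.re / _), contraPoly_real_mul _ _ (-c.im / _),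
      fieldOf_add, fieldOf_real_mul, fieldOf_real_mul, ← Zminus_eq h, ← Zplus_eq h]
    exact add_mem
      (Submodule.smul_mem _ _ (Submodule.subset_span ⟨Sum.inr (Sum.inr ⟨m + 1, hmem⟩), rfl⟩))
      (Submodule.smul_mem _ _ (Submodule.subset_span ⟨Sum.inr (Sum.inl ⟨m + 1, hmem⟩), rfl⟩))

/-! ### The contragenic space as a real vector space, and the theorem -/

theorem homContragenic_add {n : ℕ} {f g : R3 → R3} (hf : f ∈ homContragenic n)
    (hg : g ∈ homContragenic n) : f + g ∈ homContragenic n := by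
  obtain ⟨H, hH, rfl, hH'⟩ := mem_homContragenic_iff.1 hf
  obtain ⟨G, hG, rfl, hG'⟩ := mem_homContragenic_iff.1 hg
  refine mem_homContragenic_iff.2 ⟨H + G, add_mem hH hG, (fieldOf_add H G).symm, fun w hw => ?_⟩
  rw [conjPoly.map_add, show (H + G) * derivDBar w + (conjPoly H + conjPoly G) * derivD w
    = (H * derivDBar w + conjPoly H * derivD w) + (G * derivDBar w + conjPoly G * derivD w)
    by ring, map_add, hH' w hw, hG' w hw, add_zero]

theorem homContragenic_zero (n : ℕ) : 0 ∈ homContragenic n :=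
  mem_homContragenic_iff.2 ⟨0, zero_mem _, fieldOf_zero.symm, fun w _ => by simp⟩

theorem homContragenic_smul {n : ℕ} (r : ℝ) {f : R3 → R3} (hf : f ∈ homContragenic n) :
    r • f ∈ homContragenic n := by
  obtain ⟨H, hH, rfl, hH'⟩ := mem_homContragenic_iff.1 hf
  have hmem : .C (r : ℂ) * H ∈ harmonicSubmodule n := by
    rw [← MvPolynomial.smul_eq_C_mul]
    exact Submodule.smul_mem _ _ hH
  rw [← fieldOf_real_mul]
  refine mem_homContragenic_iff.2 ⟨_, hmem, rfl, fun w hw => ?_⟩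
  have he : .C (r : ℂ) * H * derivDBar w + conjPoly (.C (r : ℂ) * H) * derivD w
      = .C (r : ℂ) * (H * derivDBar w + conjPoly H * derivD w) := by
    rw [conjPoly.map_mul, conjPoly_C, Complex.conj_ofReal]
    ring
  rw [he, ballIntegral_C_mul, hH' w hw, mul_zero]

/-- The contragenic polynomials as a real vector space. -/
noncomputable def contragenicSubmodule (n : ℕ) : Submodule ℝ (R3 → R3) where
  carrier := homContragenic n
  add_mem' := homContragenic_add
  zero_mem' := homContragenic_zero n
  smul_mem' r _ := homContragenic_smul r

theorem mainTheorem2 (n : ℕ) (hn : 1 ≤ n) :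
    Fintype.card (ZIndex n) = 2 * n - 1 ∧
    (∀ i j : ZIndex n, i ≠ j → ballInner (Zfamily n i) (Zfamily n j) = 0) ∧
    LinearIndependent ℝ (Zfamily n) ∧
    (Submodule.span ℝ (Set.range (Zfamily n)) : Set (R3 → R3)) = homContragenic n := by
  refine ⟨?_, fun i j hij => ballInner_Zfamily_of_ne hn hij, linearIndependent_Zfamily hn, ?_⟩
  · simp
    omega
  · refine Set.Subset.antisymm ?_ fun h hh => ?_
    · have : Submodule.span ℝ (Set.range (Zfamily n)) ≤ contragenicSubmodule n := by
        rw [Submodule.span_le]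
        rintro _ ⟨i, rfl⟩
        rw [Zfamily_eq hn]
        exact fieldOf_contraPoly_mem (zParam_lt hn i) _
      exact this
    · obtain ⟨H, hH, rfl, hw⟩ := mem_homContragenic_iff.1 hh
      obtain ⟨c, rfl⟩ := exists_eq_sum_contraPoly hn hH
        ((forall_harmonic_iff_forall_solidPoly H).1 hw)
      rw [fieldOf_sum]
      exact Submodule.sum_mem _ fun m hm => fieldOf_contraPoly_mem_span (Finset.mem_range.1 hm) _
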